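/- For $0\le k<1$ let $K(k)=\int_0^{\pi/2}\frac{d\theta}{\sqrt{1-k^2\sin^2\theta}}$. For $r>0$ let $k_r$ be the unique $k\in(0,1)$ with $K(\sqrt{1-k^2})/K(k)=\sqrt r$, and put $k'_r=\sqrt{1-k_r^2}$, $K=K(k_r)$ and $q=e^{-\pi\sqrt r}$. Define $$\mathrm{cd}_1(q,u)=\frac{2\pi}{Kk_r}\sum_{n=0}^{\infty}\frac{(-1)^n q^{n+1/2}\cos\left((2n+3)\frac{\pi}{2K}u\right)}{1-q^{2n+1}}$$ for every complex $u$ for which the series converges. Then for every $r>0$: (i) the series defining $\mathrm{cd}_1(q,K/2)$ and the series below converge absolutely, and $$\mathrm{cd}_1\left(q,\frac K2\right)=\frac{1}{\sqrt{1+k'_r}}-\frac{\pi\sqrt 8}{Kk_r}\sum_{n\ge 0,\ n\equiv 1\,(4)}\frac{(-1)^{(n-1)/4}q^{n/2}}{1-q^n};$$ (ii) the series below converges absolutely, and $$-\sum_{n=1}^{\infty}\chi(n)\frac{q^{n/2}}{1-q^n}=\frac{Kk_r}{\sqrt2\,\pi\sqrt{1+k'_r}},$$ where $\chi(n)=\left(\frac{n+2}{8}\right)$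 is the Kronecker symbol (the extension of the Jacobi symbol to even lower entries), that is, $\chi(n)=0$ for even $n$, $\chi(n)=1$ for $n\equiv 5,7\pmod 8$ and $\chi(n)=-1$ for $n\equiv 1,3\pmod 8$. -/

import Mathlib

/-- The integrand of the complete elliptic integral of the first kind at modulus `k`. -/
noncomputable def ellipticIntegrand (k θ : ℝ) : ℝ :=
  1 / √(1 - k ^ 2 * Real.sin θ ^ 2)

/-- The complete elliptic integral of the first kind `K(k)`, as a function of the modulus `k`. -/
noncomputable def ellipticK (k : ℝ) : ℝ :=
  ∫ θ in (0 : ℝ)..(Real.pi / 2), ellipticIntegrand k θ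

/-- The modulus complementary to `k`. -/
noncomputable def complModulus (k : ℝ) : ℝ := √(1 - k ^ 2)

/-- `k` is an elliptic modulus in `(0, 1)` with `K(k') / K(k) = √r`. -/
def IsSingularModulus (r k : ℝ) : Prop :=
  0 < k ∧ k < 1 ∧ ellipticK (complModulus k) / ellipticK k = √r

/-- The singular modulus `k_r`: for `r > 0`, the only `k` in `(0, 1)` with `K(k') / K(k) = √r`
(see `existsUnique_isSingularModulus` and `singularModulus_spec` below). -/
noncomputable def singularModulus (r : ℝ) : ℝ :=
  Classical.epsilon (IsSingularModulus r)

/-- The nome `q = exp (-π √r)`. -/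
noncomputable def nome (r : ℝ) : ℝ := Real.exp (-(Real.pi * √r))

/-- The `n`-th term of the trigonometric series that defines `cd₁ (q, u)`,
where `q = nome r` and `K = K(k_r)`. -/
noncomputable def cdOneTerm (r : ℝ) (u : ℂ) (n : ℕ) : ℂ :=
  (-1) ^ n * ((nome r ^ ((n : ℝ) + 1 / 2) : ℝ) : ℂ) *
    Complex.cos ((2 * (n : ℂ) + 3) * ((Real.pi : ℂ) / (2 * (ellipticK (singularModulus r) : ℂ))) * u)
    / (1 - (nome r : ℂ) ^ (2 * n + 1))

/-- The function `cd₁ (q, u)`, where `q = nome r`. -/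
noncomputable def cdOne (r : ℝ) (u : ℂ) : ℂ :=
  2 * (Real.pi : ℂ) / ((ellipticK (singularModulus r) : ℂ) * (singularModulus r : ℂ)) *
    ∑' n : ℕ, cdOneTerm r u n

/-- The Kronecker symbol `(a / b)`: the extension of the Jacobi symbol to all lower entries
`b ≥ 0` with `(a / 2) = 0` for even `a`, `(a / 2) = 1` for `a ≡ ±1 (mod 8)` and
`(a / 2) = -1` for `a ≡ ±3 (mod 8)`, which is `ZMod.χ₈ a`; `b` is split as a power of two
times an odd number. (Mathlib's `jacobiSym` is the Jacobi symbol for odd lower entries only.) -/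
def kroneckerSym (a : ℤ) (b : ℕ) : ℤ :=
  if b = 0 then (if a.natAbs = 1 then 1 else 0)
  else ZMod.χ₈ (a : ZMod 8) ^ b.factorization 2 * jacobiSym a (b / 2 ^ b.factorization 2)

section SingularModulusExists

theorem one_sub_mul_sin_sq_pos {k : ℝ} (hk0 : 0 ≤ k) (hk1 : k < 1) (θ : ℝ) :
    1 - k ^ 2 ≤ 1 - k ^ 2 * Real.sin θ ^ 2 ∧ 0 < 1 - k ^ 2 := by
  have h1 := Real.sin_sq_le_one θ
  constructor <;> nlinarith [sq_nonneg k, sq_nonneg (Real.sin θ)]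

theorem continuous_ellipticIntegrand {k : ℝ} (hk0 : 0 ≤ k) (hk1 : k < 1) :
    Continuous (ellipticIntegrand k) := by
  unfold ellipticIntegrand
  refine Continuous.div continuous_const (by fun_prop) fun θ => ?_
  have := one_sub_mul_sin_sq_pos hk0 hk1 θ
  exact (Real.sqrt_pos.2 (by linarith)).ne'

theorem intervalIntegrable_ellipticIntegrand {k : ℝ} (hk0 : 0 ≤ k) (hk1 : k < 1) (a b : ℝ) :
    IntervalIntegrable (ellipticIntegrand k) MeasureTheory.volume a b :=
  (continuous_ellipticIntegrand hk0 hk1).intervalIntegrable a b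

theorem ellipticIntegrand_le {k l : ℝ} (hk0 : 0 ≤ k) (hkl : k ≤ l) (hl : l < 1) (θ : ℝ) :
    ellipticIntegrand k θ ≤ ellipticIntegrand l θ := by
  unfold ellipticIntegrand
  have := one_sub_mul_sin_sq_pos (hk0.trans hkl) hl θ
  apply one_div_le_one_div_of_le (Real.sqrt_pos.2 (by linarith))
  apply Real.sqrt_le_sqrt
  have : k ^ 2 ≤ l ^ 2 := by gcongr
  nlinarith [sq_nonneg (Real.sin θ)]

theorem ellipticK_mono {k l : ℝ} (hk0 : 0 ≤ k) (hkl : k ≤ l) (hl : l < 1) :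
    ellipticK k ≤ ellipticK l :=
  intervalIntegral.integral_mono_on (by positivity)
    (intervalIntegrable_ellipticIntegrand hk0 (hkl.trans_lt hl) _ _)
    (intervalIntegrable_ellipticIntegrand (hk0.trans hkl) hl _ _)
    fun θ _ => ellipticIntegrand_le hk0 hkl hl θ

theorem ellipticK_strictMono {k l : ℝ} (hk0 : 0 ≤ k) (hkl : k < l) (hl : l < 1) :
    ellipticK k < ellipticK l := by
  refine intervalIntegral.integral_lt_integral_of_continuousOn_of_le_of_exists_lt (by positivity)
    (continuous_ellipticIntegrand hk0 (hkl.trans hl)).continuousOn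
    (continuous_ellipticIntegrand (hk0.trans hkl.le) hl).continuousOn
    (fun θ _ => ellipticIntegrand_le hk0 hkl.le hl θ)
    ⟨Real.pi / 2, ⟨by positivity, le_rfl⟩, ?_⟩
  simp only [ellipticIntegrand, Real.sin_pi_div_two, one_pow, mul_one]
  have := (one_sub_mul_sin_sq_pos (hk0.trans hkl.le) hl 0).2
  apply one_div_lt_one_div_of_lt (Real.sqrt_pos.2 this)
  apply Real.sqrt_lt_sqrt this.le
  have : k ^ 2 < l ^ 2 := by gcongr
  linarith

theorem ellipticK_pos {k : ℝ} (hk0 : 0 ≤ k) (hk1 : k < 1) : 0 < ellipticK k := by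
  refine intervalIntegral.intervalIntegral_pos_of_pos_on
    (intervalIntegrable_ellipticIntegrand hk0 hk1 _ _) (fun θ _ => ?_) (by positivity)
  have := one_sub_mul_sin_sq_pos hk0 hk1 θ
  exact one_div_pos.2 (Real.sqrt_pos.2 (by linarith))

theorem complModulus_mem {k : ℝ} (hk0 : 0 < k) (hk1 : k < 1) :
    0 < complModulus k ∧ complModulus k < 1 := by
  unfold complModulus
  refine ⟨Real.sqrt_pos.2 (by nlinarith), ?_⟩
  rw [Real.sqrt_lt' one_pos]
  nlinarith

theorem complModulus_complModulus {k : ℝ} (hk0 : 0 < k) (hk1 : k < 1) :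
    complModulus (complModulus k) = k := by
  unfold complModulus
  rw [Real.sq_sqrt (by nlinarith), sub_sub_cancel, Real.sqrt_sq hk0.le]

theorem complModulus_lt {k l : ℝ} (hk0 : 0 < k) (hkl : k < l) (hl : l < 1) :
    complModulus l < complModulus k := by
  unfold complModulus
  apply Real.sqrt_lt_sqrt (by nlinarith)
  nlinarith

theorem log_le_ellipticK_complModulus {a : ℝ} (ha0 : 0 < a) (ha1 : a < 1) :
    -Real.log a ≤ ellipticK (complModulus a) := by
  obtain ⟨h0, h1⟩ := complModulus_mem ha0 ha1
  have hpi := Real.two_le_pi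
  have hsq : complModulus a ^ 2 = 1 - a ^ 2 := Real.sq_sqrt (by nlinarith)
  have hint : ∫ t in (0 : ℝ)..(Real.pi / 2), (t + a)⁻¹ = Real.log ((Real.pi / 2 + a) / a) := by
    rw [intervalIntegral.integral_comp_add_right (fun x : ℝ => x⁻¹), zero_add,
      integral_inv_of_pos ha0 (by positivity)]
  have hlog : -Real.log a ≤ Real.log ((Real.pi / 2 + a) / a) := by
    rw [← Real.log_inv]
    apply Real.log_le_log (by positivity)
    rw [inv_eq_one_div]
    gcongr
    linarith
  refine hlog.trans ?_
  rw [← hint]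
  have hrefl : ellipticK (complModulus a) =
      ∫ t in (0 : ℝ)..(Real.pi / 2), ellipticIntegrand (complModulus a) (Real.pi / 2 - t) := by
    rw [intervalIntegral.integral_comp_sub_left (ellipticIntegrand (complModulus a))]
    simp [ellipticK]
  rw [hrefl]
  refine intervalIntegral.integral_mono_on (by positivity) ?_ ?_ fun t ht => ?_
  · refine ContinuousOn.intervalIntegrable ?_
    rw [Set.uIcc_of_le (by positivity)]
    refine ContinuousOn.inv₀ (by fun_prop) fun t ht => ?_
    have := ht.1
    positivity
  · exact ((continuous_ellipticIntegrand h0.le h1).comp (by fun_prop)).intervalIntegrable _ _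
  · unfold ellipticIntegrand
    rw [inv_eq_one_div]
    have hp := one_sub_mul_sin_sq_pos h0.le h1 (Real.pi / 2 - t)
    apply one_div_le_one_div_of_le (Real.sqrt_pos.2 (by linarith))
    have ht0 : 0 ≤ t := ht.1
    apply Real.sqrt_le_iff.2 ⟨by positivity, ?_⟩
    rw [hsq, Real.sin_pi_div_two_sub]
    have hs : Real.sin t ≤ t := Real.sin_le ht0
    have hs0 : 0 ≤ Real.sin t :=
      Real.sin_nonneg_of_nonneg_of_le_pi ht0 (by linarith [ht.2])
    nlinarith [Real.sin_sq_add_cos_sq t, sq_nonneg (Real.cos t), sq_nonneg (Real.sin t),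
      mul_nonneg ht0 ha0.le, mul_nonneg (sq_nonneg a) (sq_nonneg (Real.sin t))]

theorem continuousOn_ellipticK : ContinuousOn ellipticK (Set.Ioo 0 1) := by
  intro k hk
  obtain ⟨c, hkc, hc1⟩ := exists_between hk.2
  have hc0 : 0 < c := hk.1.trans hkc
  have hε : 0 < 1 - c ^ 2 := by nlinarith
  have hcont : Continuous fun x : ℝ => ∫ θ in (0 : ℝ)..(Real.pi / 2),
      1 / √(max (1 - c ^ 2) (1 - x ^ 2 * Real.sin θ ^ 2)) := by
    apply intervalIntegral.continuous_parametric_intervalIntegral_of_continuous'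
    refine Continuous.div continuous_const (by fun_prop) fun p => ?_
    exact (Real.sqrt_pos.2 (lt_max_of_lt_left hε)).ne'
  refine ContinuousAt.continuousWithinAt (hcont.continuousAt.congr ?_)
  filter_upwards [Ioo_mem_nhds hk.1 hkc] with x hx
  unfold ellipticK ellipticIntegrand
  congr 1
  ext θ
  have := (one_sub_mul_sin_sq_pos hx.1.le (hx.2.trans hc1) θ).1
  have hxc : x ^ 2 ≤ c ^ 2 := by
    have := hx.1.le
    have := hx.2.le
    gcongr
  rw [max_eq_right (by linarith)]

/-- For every bound `M`, some modulus `a` has `K(a) ≤ K(1/2)` and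
`K(a')` larger than `M`. -/
theorem exists_small_modulus (M : ℝ) :
    ∃ a, 0 < a ∧ a < 1 ∧ ellipticK a ≤ ellipticK (1 / 2) ∧ M < ellipticK (complModulus a) := by
  refine ⟨min (1 / 2) (Real.exp (-(M + 1))), by positivity,
    (min_le_left _ _).trans_lt (by norm_num),
    ellipticK_mono (by positivity) (min_le_left _ _) (by norm_num), ?_⟩
  set a := min (1 / 2) (Real.exp (-(M + 1))) with ha
  have ha0 : 0 < a := by positivity
  have ha1 : a < 1 := (min_le_left _ _).trans_lt (by norm_num)
  have h := log_le_ellipticK_complModulus ha0 ha1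
  have h2 : Real.log a ≤ -(M + 1) := by
    rw [← Real.log_exp (-(M + 1))]
    exact Real.log_le_log ha0 (min_le_right _ _)
  linarith

/-- The singular modulus exists and is unique for each `r > 0`. -/
theorem existsUnique_isSingularModulus {r : ℝ} (hr : 0 < r) : ∃! k, IsSingularModulus r k := by
  have hs : 0 < √r := Real.sqrt_pos.2 hr
  have hC := ellipticK_pos (k := 1 / 2) (by norm_num) (by norm_num)
  set f : ℝ → ℝ := fun k => ellipticK (complModulus k) - √r * ellipticK k with hf
  have hcont : ContinuousOn f (Set.Ioo 0 1) := by
    refine ContinuousOn.sub (continuousOn_ellipticK.comp ?_ fun k hk =>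
      complModulus_mem hk.1 hk.2) (continuousOn_const.mul continuousOn_ellipticK)
    unfold complModulus
    fun_prop
  obtain ⟨a, ha0, ha1, haK, haM⟩ := exists_small_modulus (√r * ellipticK (1 / 2))
  obtain ⟨b, hb0, hb1, hbK, hbM⟩ := exists_small_modulus (ellipticK (1 / 2) / √r)
  obtain ⟨hc0, hc1⟩ := complModulus_mem hb0 hb1
  have hfa : 0 ≤ f a := by
    have := mul_le_mul_of_nonneg_left haK hs.le
    simp only [hf]
    linarith
  have hfb : f (complModulus b) ≤ 0 := by
    have : ellipticK (1 / 2) < √r * ellipticK (complModulus b) := by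
      rwa [div_lt_iff₀' hs] at hbM
    simp only [hf, complModulus_complModulus hb0 hb1]
    linarith
  obtain ⟨k, hk, hfk⟩ : ∃ k ∈ Set.Ioo (0 : ℝ) 1, f k = 0 :=
    isPreconnected_Ioo.intermediate_value (⟨hc0, hc1⟩ : complModulus b ∈ Set.Ioo (0 : ℝ) 1)
      (⟨ha0, ha1⟩ : a ∈ Set.Ioo (0 : ℝ) 1) hcont ⟨hfb, hfa⟩
  have key : ∀ {x y : ℝ}, IsSingularModulus r x → IsSingularModulus r y → ¬ x < y := by
    rintro x y ⟨hx0, hx1, hx⟩ ⟨hy0, hy1, hy⟩ hxy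
    rw [div_eq_iff (ellipticK_pos hx0.le hx1).ne'] at hx
    rw [div_eq_iff (ellipticK_pos hy0.le hy1).ne'] at hy
    have h1 := ellipticK_strictMono hx0.le hxy hy1
    have h2 := ellipticK_mono (complModulus_mem hy0 hy1).1.le
      (complModulus_lt hx0 hxy hy1).le (complModulus_mem hx0 hx1).2
    nlinarith
  have hk' : IsSingularModulus r k := by
    refine ⟨hk.1, hk.2, ?_⟩
    rw [div_eq_iff (ellipticK_pos hk.1.le hk.2).ne']
    simpa [hf, sub_eq_zero] using hfk
  exact ⟨k, hk', fun l hl => le_antisymm (not_lt.1 (key hk' hl)) (not_lt.1 (key hl hk'))⟩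

theorem singularModulus_spec {r : ℝ} (hr : 0 < r) : IsSingularModulus r (singularModulus r) :=
  Classical.epsilon_spec (existsUnique_isSingularModulus hr).exists

end SingularModulusExists

/-! ### Theta series with quadratic exponents -/

/-! Let φ(q) = Σ q^(n²) and ψ(q) = Σ q^(2n²+n), over all integers n. Then φ(±q) is `quadTheta (±1) q
1 0`, ψ(±q) is `quadTheta (±1) q 2 1`, and `quadTheta 1 q 1 1` is 2ψ(q²).

Lambert side of (ii). Expand 1/(1 - qⁿ) geometrically and sum over n first. Since χ(n+4) = -χ(n),
the left side becomes Σ (x + x³)/(1 + x⁴) over x = q^(m+1/2), m ≥ 0, which unfolds to the bilateral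
series q^(3/2) Σ q^(3n)/(1 + q^(4n+2)). Kronecker's formula (`sechSeries_mul_theta`) writes such a
series as a constant times a quotient of theta series. The constant comes from the two squares
theorem (`sechSeries_one_one`), and the value is √q φ(q) ψ(q⁴) (`mul_sechSeries_self`).

Elliptic side of (ii). Gauss's transformation preserves `gaussIntegral` under one step of the
arithmetic-geometric mean, and on the pair φ(q)², φ(-q)² that step is q ↦ q². Letting q → 0 gives K
= (π/2) φ(q)² for k' = φ(-q)²/φ(q)². Poisson summation interchanges k and k' when √r becomes 1/√r,
so this k has K(k')/K(k) = √r and is k_r. The duplication formulas then reduce the right side of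
(ii) to √q φ(q) ψ(q⁴) as well.

For (i), at u = K/2 the factor (-1)ⁿ cos((2n+3)π/4) splits into a multiple of χ(2n+1), summed by
(ii), and a term living on even n, which is the series over n ≡ 1 (mod 4). -/

theorem tsum_eq_add_of_isCompl_range {α β γ : Type*} {i : β → α} {j : γ → α}
    (hi : Function.Injective i) (hj : Function.Injective j)
    (h : IsCompl (Set.range i) (Set.range j)) {f : α → ℝ} (hf : Summable f) :
    ∑' x, f x = ∑' y, f (i y) + ∑' z, f (j z) := by
  rw [← Summable.tsum_add_tsum_compl (s := Set.range i) (hf.subtype _) (hf.subtype _),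
    h.compl_eq, tsum_range f hi, tsum_range f hj]

theorem isCompl_range_even_odd :
    IsCompl (Set.range fun m : ℤ => 2 * m) (Set.range fun m : ℤ => 2 * m + 1) := by
  rw [isCompl_iff, Set.disjoint_left, codisjoint_iff]
  constructor
  · rintro _ ⟨m, rfl⟩ ⟨n, h⟩
    simp only at h
    omega
  · refine Set.eq_univ_iff_forall.2 fun n => ?_
    rcases Int.even_or_odd' n with ⟨m, h | h⟩
    · exact Or.inl ⟨m, h.symm⟩
    · exact Or.inr ⟨m, h.symm⟩

theorem tsum_int_eq_even_add_odd {f : ℤ → ℝ} (hf : Summable f) :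
    ∑' n, f n = ∑' m : ℤ, f (2 * m) + ∑' m : ℤ, f (2 * m + 1) :=
  tsum_eq_add_of_isCompl_range (fun a b h => by simpa using h) (fun a b h => by simpa using h)
    isCompl_range_even_odd hf

theorem tsum_int_prod_eq_diagonals {f : ℤ × ℤ → ℝ} (hf : Summable f) :
    ∑' x, f x = ∑' x : ℤ × ℤ, f (x.1 + x.2, x.1 - x.2) +
      ∑' x : ℤ × ℤ, f (x.1 + x.2 + 1, x.1 - x.2) := by
  refine tsum_eq_add_of_isCompl_range (i := fun x : ℤ × ℤ => (x.1 + x.2, x.1 - x.2))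
    (j := fun x : ℤ × ℤ => (x.1 + x.2 + 1, x.1 - x.2)) ?_ ?_ ?_ hf
  · rintro ⟨a, b⟩ ⟨c, d⟩ h
    simp only [Prod.mk.injEq] at h ⊢
    omega
  · rintro ⟨a, b⟩ ⟨c, d⟩ h
    simp only [Prod.mk.injEq] at h ⊢
    omega
  · rw [isCompl_iff, Set.disjoint_left, codisjoint_iff]
    constructor
    · rintro _ ⟨⟨a, b⟩, rfl⟩ ⟨⟨c, d⟩, h⟩
      simp only [Prod.mk.injEq] at h
      omega
    · refine Set.eq_univ_iff_forall.2 fun ⟨a, b⟩ => ?_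
      rcases Int.even_or_odd' (a + b) with ⟨m, h | h⟩
      · exact Or.inl ⟨(m, a - m), by simp only [Prod.mk.injEq]; omega⟩
      · exact Or.inr ⟨(m, a - m - 1), by simp only [Prod.mk.injEq]; omega⟩

/-- The theta series `∑ εⁿ q ^ (a n² + b n)` over all integers `n`. -/
noncomputable def quadTheta (ε q : ℝ) (a b : ℤ) : ℝ := ∑' n : ℤ, ε ^ n * q ^ (a * n ^ 2 + b * n)

theorem abs_zpow_of_sq_eq_one {ε : ℝ} (hε : ε ^ 2 = 1) (n : ℤ) : |ε ^ n| = 1 := by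
  rcases eq_or_eq_neg_of_sq_eq_sq ε 1 (hε.trans (one_pow 2).symm) with rfl | rfl <;> simp [abs_zpow]

theorem summable_quad_nat {q : ℝ} (hq0 : 0 < q) (hq1 : q < 1) {a : ℤ} (ha : 1 ≤ a) (b : ℤ) :
    Summable fun n : ℕ => q ^ (a * (n : ℤ) ^ 2 + b * n) := by
  -- The constant comes from n² + (b-1)n + (b-1)² ≥ 0, that is, n² + bn ≥ n - (b-1)².
  refine Summable.of_nonneg_of_le (fun n => by positivity) (fun n => ?_)
    ((summable_geometric_of_lt_one hq0.le hq1).mul_left (q ^ (-(b - 1) ^ 2)))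
  rw [← zpow_natCast q n, ← zpow_add₀ hq0.ne']
  apply zpow_le_zpow_right_of_le_one₀ hq0 hq1.le
  nlinarith [sq_nonneg ((n : ℤ) + (b - 1)), sq_nonneg (n : ℤ), sq_nonneg (b - 1)]

theorem summable_quad {q : ℝ} (hq0 : 0 < q) (hq1 : q < 1) {a : ℤ} (ha : 1 ≤ a) (b : ℤ) :
    Summable fun n : ℤ => q ^ (a * n ^ 2 + b * n) := by
  refine Summable.of_nat_of_neg (summable_quad_nat hq0 hq1 ha b) ?_
  refine (summable_quad_nat hq0 hq1 ha (-b)).congr fun n => ?_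
  ring_nf

theorem summable_norm_quadTheta {ε q : ℝ} (hε : ε ^ 2 = 1) (hq0 : 0 < q) (hq1 : q < 1)
    {a : ℤ} (ha : 1 ≤ a) (b : ℤ) : Summable fun n : ℤ => ‖ε ^ n * q ^ (a * n ^ 2 + b * n)‖ := by
  refine (summable_quad hq0 hq1 ha b).congr fun n => ?_
  rw [norm_mul, Real.norm_eq_abs, abs_zpow_of_sq_eq_one hε, one_mul, Real.norm_eq_abs,
    abs_of_pos (by positivity)]

theorem summable_quadTheta {ε q : ℝ} (hε : ε ^ 2 = 1) (hq0 : 0 < q) (hq1 : q < 1)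
    {a : ℤ} (ha : 1 ≤ a) (b : ℤ) : Summable fun n : ℤ => ε ^ n * q ^ (a * n ^ 2 + b * n) :=
  (summable_norm_quadTheta hε hq0 hq1 ha b).of_norm

theorem quadTheta_one_pos {q : ℝ} (hq0 : 0 < q) (hq1 : q < 1) {a : ℤ} (ha : 1 ≤ a) (b : ℤ) :
    0 < quadTheta 1 q a b :=
  (summable_quadTheta (one_pow 2) hq0 hq1 ha b).tsum_pos (fun n => by positivity) 0 (by positivity)

theorem quadTheta_sq (ε q : ℝ) (a b : ℤ) :
    quadTheta ε (q ^ 2) a b = quadTheta ε q (2 * a) (2 * b) := by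
  refine tsum_congr fun n => ?_
  rw [← zpow_natCast q 2, ← zpow_mul]
  congr 2
  push_cast
  ring

theorem quadTheta_neg {ε : ℝ} (hε : ε ^ 2 = 1) (q : ℝ) (a b : ℤ) :
    quadTheta ε q a (-b) = quadTheta ε q a b := by
  unfold quadTheta
  rw [← (Equiv.neg ℤ).tsum_eq]
  refine tsum_congr fun n => ?_
  have : ε⁻¹ = ε := by
    rcases eq_or_eq_neg_of_sq_eq_sq ε 1 (hε.trans (one_pow 2).symm) with rfl | rfl <;> norm_num
  rw [Equiv.neg_apply, zpow_neg, ← inv_zpow, this]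
  ring_nf

theorem quadTheta_shift {ε q : ℝ} (hε : ε ^ 2 = 1) (hq0 : 0 < q) (a b : ℤ) :
    quadTheta ε q a b = ε * q ^ (a + b) * quadTheta ε q a (b + 2 * a) := by
  have hε0 : ε ≠ 0 := by rintro rfl; norm_num at hε
  unfold quadTheta
  rw [← (Equiv.addRight (1 : ℤ)).tsum_eq, ← tsum_mul_left]
  refine tsum_congr fun n => ?_
  rw [Equiv.coe_addRight, zpow_add_one₀ hε0,
    show a * (n + 1) ^ 2 + b * (n + 1) = (a + b) + (a * n ^ 2 + (b + 2 * a) * n) by ring,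
    zpow_add₀ hq0.ne']
  ring

/-- The reflection n ↦ -1-n fixes the exponent a n(n+1) and reverses the sign (-1)ⁿ. -/
theorem quadTheta_neg_one_self {q : ℝ} (hq0 : 0 < q) (a : ℤ) : quadTheta (-1) q a a = 0 := by
  have h := quadTheta_shift (ε := -1) (by norm_num) hq0 a (-a)
  rw [quadTheta_neg (by norm_num), add_neg_cancel, zpow_zero,
    show -a + 2 * a = a by ring] at h
  linarith

theorem quadTheta_split {ε q : ℝ} (hε : ε ^ 2 = 1) (hq0 : 0 < q) (hq1 : q < 1)
    {a : ℤ} (ha : 1 ≤ a) (b : ℤ) :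
    quadTheta ε q a b = quadTheta 1 q (4 * a) (2 * b) +
      ε * q ^ (a + b) * quadTheta 1 q (4 * a) (4 * a + 2 * b) := by
  have hε0 : ε ≠ 0 := by rintro rfl; norm_num at hε
  have h2 (m : ℤ) : ε ^ (2 * m) = 1 := by
    rw [zpow_mul, show ε ^ (2 : ℤ) = 1 by exact_mod_cast hε, one_zpow]
  unfold quadTheta
  rw [tsum_int_eq_even_add_odd (summable_quadTheta hε hq0 hq1 ha b), ← tsum_mul_left]
  congr 1 <;> refine tsum_congr fun n => ?_
  · rw [h2, one_zpow]
    ring_nf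
  · rw [zpow_add_one₀ hε0, h2, one_zpow, show a * (2 * n + 1) ^ 2 + b * (2 * n + 1) =
      (a + b) + (4 * a * n ^ 2 + (4 * a + 2 * b) * n) by ring, zpow_add₀ hq0.ne']
    ring

/-- Index pairs are sorted by the parity of their sum and rotated to u+v, u-v (or u+v+1, u-v), which
diagonalises the quadratic form again. All the duplication formulas are special cases; when εδ = -1,
`quadTheta_neg_one_self` kills the second product. -/
theorem quadTheta_mul {ε δ q : ℝ} (hε : ε ^ 2 = 1) (hδ : δ ^ 2 = 1) (hq0 : 0 < q) (hq1 : q < 1)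
    {a : ℤ} (ha : 1 ≤ a) (b : ℤ) :
    quadTheta ε q a b * quadTheta δ q a b =
      quadTheta (ε * δ) q (2 * a) (2 * b) * quadTheta (ε * δ) q (2 * a) 0 +
      ε * q ^ (a + b) * (quadTheta (ε * δ) q (2 * a) (2 * a + 2 * b) *
        quadTheta (ε * δ) q (2 * a) (2 * a)) := by
  have hεδ : (ε * δ) ^ 2 = 1 := by rw [mul_pow, hε, hδ, one_mul]
  have hε0 : ε ≠ 0 := by rintro rfl; norm_num at hε
  have hδ0 : δ ≠ 0 := by rintro rfl; norm_num at hδ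
  have hinv : δ⁻¹ = δ := by
    rcases eq_or_eq_neg_of_sq_eq_sq δ 1 (hδ.trans (one_pow 2).symm) with rfl | rfl <;> norm_num
  have hsub (u v : ℤ) : δ ^ (u - v) = δ ^ u * δ ^ v := by
    rw [sub_eq_add_neg, zpow_add₀ hδ0, zpow_neg, ← inv_zpow, hinv]
  have ha2 : 1 ≤ 2 * a := by omega
  unfold quadTheta
  rw [tsum_mul_tsum_of_summable_norm (summable_norm_quadTheta hε hq0 hq1 ha b)
      (summable_norm_quadTheta hδ hq0 hq1 ha b),
    tsum_int_prod_eq_diagonals (summable_mul_of_summable_norm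
      (summable_norm_quadTheta hε hq0 hq1 ha b) (summable_norm_quadTheta hδ hq0 hq1 ha b)),
    tsum_mul_tsum_of_summable_norm (summable_norm_quadTheta hεδ hq0 hq1 ha2 _)
      (summable_norm_quadTheta hεδ hq0 hq1 ha2 _),
    tsum_mul_tsum_of_summable_norm (summable_norm_quadTheta hεδ hq0 hq1 ha2 _)
      (summable_norm_quadTheta hεδ hq0 hq1 ha2 _), ← tsum_mul_left]
  congr 1 <;> refine tsum_congr fun ⟨u, v⟩ => ?_
  · simp only [hsub, zpow_add₀ hε0, mul_zpow]
    have : q ^ (a * (u + v) ^ 2 + b * (u + v)) * q ^ (a * (u - v) ^ 2 + b * (u - v)) =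
        q ^ (2 * a * u ^ 2 + 2 * b * u) * q ^ (2 * a * v ^ 2 + 0 * v) := by
      rw [← zpow_add₀ hq0.ne', ← zpow_add₀ hq0.ne']
      ring_nf
    linear_combination ε ^ u * ε ^ v * δ ^ u * δ ^ v * this
  · simp only [hsub, zpow_add₀ hε0, mul_zpow, zpow_one]
    have : q ^ (a * (u + v + 1) ^ 2 + b * (u + v + 1)) * q ^ (a * (u - v) ^ 2 + b * (u - v)) =
        q ^ (a + b) * (q ^ (2 * a * u ^ 2 + (2 * a + 2 * b) * u) *
          q ^ (2 * a * v ^ 2 + 2 * a * v)) := by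
      rw [← zpow_add₀ hq0.ne', ← zpow_add₀ hq0.ne', ← zpow_add₀ hq0.ne']
      ring_nf
    linear_combination ε * ε ^ u * ε ^ v * δ ^ u * δ ^ v * this

/-! ### Duplication formulas relating theta series at q and q² -/

section Doubling

variable {q : ℝ}

theorem quadTheta_sq_eq {ε : ℝ} (hε : ε ^ 2 = 1) (hq0 : 0 < q) (hq1 : q < 1) :
    quadTheta ε q 1 0 ^ 2 =
      quadTheta 1 (q ^ 2) 1 0 ^ 2 + ε * q * quadTheta 1 (q ^ 2) 1 1 ^ 2 := by
  have h := quadTheta_mul hε hε hq0 hq1 le_rfl 0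
  rw [← sq ε, hε] at h
  rw [quadTheta_sq, quadTheta_sq, sq, h]
  norm_num
  ring

theorem quadTheta_one_mul_neg_one (hq0 : 0 < q) (hq1 : q < 1) :
    quadTheta 1 q 1 0 * quadTheta (-1) q 1 0 = quadTheta (-1) (q ^ 2) 1 0 ^ 2 := by
  have h := quadTheta_mul (ε := 1) (δ := -1) (by norm_num) (by norm_num) hq0 hq1 le_rfl 0
  rw [quadTheta_sq, h, one_mul, quadTheta_neg_one_self hq0]
  norm_num
  ring

theorem quadTheta_one_one_sq (hq0 : 0 < q) (hq1 : q < 1) :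
    quadTheta 1 q 1 1 ^ 2 = 2 * quadTheta 1 (q ^ 2) 1 1 * quadTheta 1 (q ^ 2) 1 0 := by
  have h := quadTheta_mul (ε := 1) (δ := 1) (by norm_num) (by norm_num) hq0 hq1 le_rfl 1
  have h2 := quadTheta_shift (ε := 1) (by norm_num) hq0 2 0
  norm_num at h h2
  rw [quadTheta_sq, quadTheta_sq, sq, h]
  norm_num
  rw [h2]
  ring

theorem quadTheta_two_one_sq {ε : ℝ} (hε : ε ^ 2 = 1) (hq0 : 0 < q) (hq1 : q < 1) :
    quadTheta ε q 2 1 ^ 2 = quadTheta 1 (q ^ 2) 2 1 * quadTheta ε q 1 0 := by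
  have h := quadTheta_mul hε hε hq0 hq1 one_le_two 1
  rw [← sq ε, hε] at h
  -- The shift turns the linear coefficient 6 of the second product into 2, so a common factor comes
  -- out; the cofactor is the even/odd splitting of φ(εq).
  have h2 := quadTheta_shift (ε := 1) (by norm_num) hq0 4 (-2)
  rw [quadTheta_neg (by norm_num)] at h2
  have h3 := quadTheta_split hε hq0 hq1 le_rfl 0
  norm_num at h h2 h3
  rw [quadTheta_sq, sq, h, h3]
  norm_num
  rw [h2]
  ring

theorem quadTheta_two_one_mul (hq0 : 0 < q) (hq1 : q < 1) :
    quadTheta 1 q 2 1 * quadTheta (-1) q 2 1 =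
      quadTheta (-1) (q ^ 2) 2 1 * quadTheta (-1) ((q ^ 2) ^ 2) 1 0 := by
  have h := quadTheta_mul (ε := 1) (δ := -1) (by norm_num) (by norm_num) hq0 hq1 one_le_two 1
  rw [h, one_mul, quadTheta_neg_one_self hq0, quadTheta_sq, quadTheta_sq, quadTheta_sq]
  norm_num

end Doubling

/-! ### Limits as q → 0 and descent along q, q², q⁴, … -/

section SmallNome

theorem abs_tsum_sub_le {q : ℝ} (hq0 : 0 ≤ q) (hq1 : q < 1) {f : ℤ → ℝ}
    (hf : ∀ n : ℤ, n ≠ 0 → |f n| ≤ q ^ n.natAbs) : |∑' n, f n - f 0| ≤ 2 * q / (1 - q) := by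
  have hg : HasSum (fun n : ℕ => q ^ (n + 1)) (q / (1 - q)) := by
    simpa [pow_succ, div_eq_mul_inv, mul_comm] using
      (hasSum_geometric_of_lt_one hq0 hq1).mul_right q
  have hb1 (n : ℕ) : ‖f ((n : ℤ) + 1)‖ ≤ q ^ (n + 1) := by
    have := hf ((n : ℤ) + 1) (by omega)
    rwa [show ((n : ℤ) + 1).natAbs = n + 1 by omega] at this
  have hb2 (n : ℕ) : ‖f (-((n : ℤ) + 1))‖ ≤ q ^ (n + 1) := by
    have := hf (-((n : ℤ) + 1)) (by omega)
    rwa [show (-((n : ℤ) + 1)).natAbs = n + 1 by omega] at this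
  have h1 := tsum_of_norm_bounded hg hb1
  have h2 := tsum_of_norm_bounded hg hb2
  have s1 : Summable fun n : ℕ => f ((n : ℤ) + 1) := Summable.of_norm_bounded hg.summable hb1
  have s2 : Summable fun n : ℕ => f (-((n : ℤ) + 1)) := Summable.of_norm_bounded hg.summable hb2
  have s3 : Summable fun n : ℕ => f n := by
    rw [← summable_nat_add_iff 1]
    exact_mod_cast s1
  rw [tsum_of_nat_of_neg_add_one s3 s2, s3.tsum_eq_zero_add]
  push_cast
  rw [Real.norm_eq_abs] at h1 h2
  have := abs_add_le (∑' n : ℕ, f ((n : ℤ) + 1)) (∑' n : ℕ, f (-((n : ℤ) + 1)))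
  calc _ = |∑' n : ℕ, f ((n : ℤ) + 1) + ∑' n : ℕ, f (-((n : ℤ) + 1))| := by
        congr 1; ring
    _ ≤ q / (1 - q) + q / (1 - q) := by linarith
    _ = _ := by ring

theorem tendsto_pow_two_pow {q : ℝ} (hq0 : 0 < q) (hq1 : q < 1) :
    Filter.Tendsto (fun n : ℕ => q ^ 2 ^ n) Filter.atTop (nhdsWithin 0 (Set.Ioo 0 1)) := by
  refine tendsto_nhdsWithin_iff.2 ⟨(tendsto_pow_atTop_nhds_zero_of_lt_one hq0.le hq1).comp
    (tendsto_pow_atTop_atTop_of_one_lt one_lt_two), ?_⟩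
  exact Filter.Eventually.of_forall fun n =>
    ⟨by positivity, pow_lt_one₀ hq0.le hq1 (by positivity)⟩

theorem tendsto_tsum_of_le_pow_natAbs {f : ℝ → ℤ → ℝ} {l : ℝ}
    (hf : ∀ q ∈ Set.Ioo (0 : ℝ) 1, ∀ n : ℤ, n ≠ 0 → |f q n| ≤ q ^ n.natAbs)
    (h0 : ∀ q ∈ Set.Ioo (0 : ℝ) 1, f q 0 = l) :
    Filter.Tendsto (fun q => ∑' n, f q n) (nhdsWithin 0 (Set.Ioo 0 1)) (nhds l) := by
  rw [tendsto_iff_norm_sub_tendsto_zero]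
  have hlim : Filter.Tendsto (fun q : ℝ => 2 * q / (1 - q)) (nhdsWithin 0 (Set.Ioo 0 1))
      (nhds 0) := by
    have : ContinuousAt (fun q : ℝ => 2 * q / (1 - q)) 0 := by
      apply ContinuousAt.div <;> first | fun_prop | norm_num
    have h2 := this.tendsto
    simp only [mul_zero, zero_div] at h2
    exact h2.mono_left nhdsWithin_le_nhds
  refine squeeze_zero' (Filter.Eventually.of_forall fun _ => norm_nonneg _) ?_ hlim
  filter_upwards [self_mem_nhdsWithin] with q hq
  have := abs_tsum_sub_le hq.1.le hq.2 (hf q hq)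
  rwa [h0 q hq] at this

/-- The hypothesis makes a n² + b n ≥ |n|, so only n = 0 survives in the limit. It excludes a = b =
1, where n = -1 contributes too. -/
theorem tendsto_quadTheta {ε : ℝ} (hε : ε ^ 2 = 1) {a b : ℤ} (hab : |b| + 1 ≤ a) :
    Filter.Tendsto (fun q => quadTheta ε q a b) (nhdsWithin 0 (Set.Ioo 0 1)) (nhds 1) := by
  refine tendsto_tsum_of_le_pow_natAbs (fun q hq n hn => ?_) (fun q hq => by simp)
  have hq0 := hq.1
  rw [abs_mul, abs_zpow_of_sq_eq_one hε, one_mul, abs_of_pos (by positivity), ← zpow_natCast q]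
  apply zpow_le_zpow_right_of_le_one₀ hq.1 hq.2.le
  have h1 : 1 ≤ |n| := Int.one_le_abs hn
  have h2 : -(|b| * |n|) ≤ b * n := by rw [← abs_mul]; exact neg_abs_le _
  rw [Int.natCast_natAbs, ← sq_abs n]
  nlinarith [mul_le_mul_of_nonneg_left h1 (abs_nonneg n), abs_nonneg b, 
    mul_nonneg (abs_nonneg b) (abs_nonneg n),
    mul_le_mul_of_nonneg_right hab (sq_nonneg |n|),
    mul_nonneg (mul_nonneg (abs_nonneg b) (abs_nonneg n)) (sub_nonneg.2 h1)]

/-- Some q^(2^N) is small enough for f to be positive there; positivity then climbs back to q by N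
square roots. This replaces the product formulas for the alternating theta series. -/
theorem pos_of_pos_sq {f : ℝ → ℝ} {l : ℝ} (hl : 0 < l)
    (hf : Filter.Tendsto f (nhdsWithin 0 (Set.Ioo 0 1)) (nhds l))
    (h : ∀ q ∈ Set.Ioo (0 : ℝ) 1, 0 < f (q ^ 2) → 0 < f q) {q : ℝ} (hq0 : 0 < q) (hq1 : q < 1) :
    0 < f q := by
  obtain ⟨N, hN⟩ := ((hf.comp (tendsto_pow_two_pow hq0 hq1)).eventually (lt_mem_nhds hl)).exists
  simp only [Function.comp_apply] at hN
  have key : ∀ n : ℕ, 0 < f (q ^ 2 ^ n) → 0 < f q := by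
    intro n
    induction n with
    | zero => simp
    | succ n ih =>
      intro h1
      refine ih (h _ ⟨by positivity, pow_lt_one₀ hq0.le hq1 (by positivity)⟩ ?_)
      rwa [← pow_mul, ← pow_succ]
  exact key N hN

/-- f is constant along q, q², q⁴, …, a sequence tending to 0. -/
theorem eq_of_eq_sq {f : ℝ → ℝ} {l : ℝ}
    (hf : Filter.Tendsto f (nhdsWithin 0 (Set.Ioo 0 1)) (nhds l))
    (h : ∀ q ∈ Set.Ioo (0 : ℝ) 1, f q = f (q ^ 2)) {q : ℝ} (hq0 : 0 < q) (hq1 : q < 1) :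
    f q = l := by
  have key (n : ℕ) : f (q ^ 2 ^ n) = f q := by
    induction n with
    | zero => simp
    | succ n ih =>
      rw [← ih, h (q ^ 2 ^ n) ⟨by positivity, pow_lt_one₀ hq0.le hq1 (by positivity)⟩, ← pow_mul,
        ← pow_succ]
  have := hf.comp (tendsto_pow_two_pow hq0 hq1)
  exact tendsto_nhds_unique (by simp only [Function.comp_def, key]; exact tendsto_const_nhds) this

theorem quadTheta_neg_one_pos {q : ℝ} (hq0 : 0 < q) (hq1 : q < 1) : 0 < quadTheta (-1) q 1 0 := by
  refine pos_of_pos_sq one_pos (tendsto_quadTheta (ε := -1) (a := 1) (b := 0) (by norm_num)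
    (by norm_num)) (fun x hx h => ?_) hq0 hq1
  have h1 := quadTheta_one_mul_neg_one hx.1 hx.2
  exact pos_of_mul_pos_right (h1 ▸ pow_pos h 2) (quadTheta_one_pos hx.1 hx.2 le_rfl 0).le

theorem quadTheta_neg_one_two_one_pos {q : ℝ} (hq0 : 0 < q) (hq1 : q < 1) :
    0 < quadTheta (-1) q 2 1 := by
  refine pos_of_pos_sq one_pos (tendsto_quadTheta (ε := -1) (a := 2) (b := 1) (by norm_num)
    (by norm_num)) (fun x hx h => ?_) hq0 hq1
  have h1 := quadTheta_two_one_mul hx.1 hx.2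
  have hx0 := hx.1
  have h2 := quadTheta_neg_one_pos (q := (x ^ 2) ^ 2) (by positivity)
    (pow_lt_one₀ (by positivity) (pow_lt_one₀ hx.1.le hx.2 two_ne_zero) two_ne_zero)
  exact pos_of_mul_pos_right (h1 ▸ mul_pos h h2) (quadTheta_one_pos hx.1 hx.2 one_le_two 1).le

/-- `φ(q) ψ(-q) = φ(-q²) ψ(q)` in Ramanujan's notation. -/
theorem quadTheta_cross {q : ℝ} (hq0 : 0 < q) (hq1 : q < 1) :
    quadTheta 1 q 1 0 * quadTheta (-1) q 2 1 =
      quadTheta (-1) (q ^ 2) 1 0 * quadTheta 1 q 2 1 := by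
  have h1 := quadTheta_one_pos hq0 hq1 le_rfl 0
  have h2 := quadTheta_neg_one_two_one_pos hq0 hq1
  have h3 := quadTheta_neg_one_pos (q := q ^ 2) (by positivity) (pow_lt_one₀ hq0.le hq1 two_ne_zero)
  have h4 := quadTheta_one_pos hq0 hq1 one_le_two 1
  -- Both sides are positive, and their squares both equal φ(q)² φ(-q) ψ(q²).
  refine (pow_left_inj₀ (by positivity) (by positivity) two_ne_zero).1 ?_
  rw [mul_pow, mul_pow, quadTheta_two_one_sq (by norm_num) hq0 hq1,
    quadTheta_two_one_sq (by norm_num) hq0 hq1, ← quadTheta_one_mul_neg_one hq0 hq1]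
  ring

end SmallNome

/-! ### Bilateral Lambert series -/

/-- The general term of the bilateral series `∑ qⁿ zⁿ / (1 + y q²ⁿ)`. -/
noncomputable def sechCoeff (q y : ℝ) (n : ℤ) : ℝ := q ^ n / (1 + y * q ^ (2 * n))

/-- The bilateral series `∑ qⁿ zⁿ / (1 + y q²ⁿ)` over all integers `n`. -/
noncomputable def sechSeries (q y z : ℝ) : ℝ := ∑' n : ℤ, sechCoeff q y n * z ^ n

section SechSeries

variable {q y z : ℝ}

theorem sechCoeff_nonneg (hq : 0 < q) (hy : 0 < y) (n : ℤ) : 0 ≤ sechCoeff q y n := by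
  unfold sechCoeff
  positivity

theorem sechCoeff_le (hq : 0 < q) (hy : 0 < y) (n : ℤ) : sechCoeff q y n ≤ q ^ n := by
  unfold sechCoeff
  exact div_le_self (by positivity) (le_add_of_nonneg_right (by positivity))

theorem sechCoeff_le_inv (hq : 0 < q) (hy : 0 < y) (n : ℤ) : sechCoeff q y n ≤ q ^ (-n) / y := by
  unfold sechCoeff
  rw [div_le_div_iff₀ (by positivity) hy, mul_comm 2 n, zpow_mul]
  have : q ^ (-n) * (q ^ n) ^ (2 : ℤ) = q ^ n := by
    rw [← zpow_mul, ← zpow_add₀ hq.ne']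
    ring_nf
  have h2 : 0 < q ^ (-n) := by positivity
  linear_combination h2.le - y * this

theorem sechCoeff_bounded (hq : 0 < q) (hq1 : q < 1) (hy : 0 < y) (n : ℤ) :
    sechCoeff q y n ≤ 1 + 1 / y := by
  rcases le_total 0 n with h | h
  · have := sechCoeff_le hq hy n
    have h2 := zpow_le_one₀ hq hq1.le h
    have : 0 < 1 / y := by positivity
    linarith
  · have := sechCoeff_le_inv hq hy n
    have h2 := zpow_le_one₀ (n := -n) hq hq1.le (by omega)
    have : q ^ (-n) / y ≤ 1 / y := by gcongr
    linarith

theorem sechCoeff_mul (hq : 0 < q) (hy : 0 < y) (n : ℤ) :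
    sechCoeff q y n * (q ^ (-n) + y * q ^ n) = 1 := by
  unfold sechCoeff
  have h : q ^ n * (q ^ (-n) + y * q ^ n) = 1 + y * q ^ (2 * n) := by
    rw [mul_add, ← zpow_add₀ hq.ne', add_neg_cancel, zpow_zero, mul_left_comm,
      ← zpow_add₀ hq.ne', two_mul]
  rw [div_mul_eq_mul_div, h, div_self]
  positivity

/-- The coefficients are O(q^|n|) in both directions, whence the annulus q < |z| < 1/q. -/
theorem summable_norm_sechSeries (hq : 0 < q) (hy : 0 < y) (h1 : q * |z| < 1) (h2 : q < |z|) :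
    Summable fun n : ℤ => ‖sechCoeff q y n * z ^ n‖ := by
  have hz : 0 < |z| := hq.trans h2
  refine Summable.of_nat_of_neg ?_ ?_
  · refine Summable.of_nonneg_of_le (fun n => norm_nonneg _) (fun n => ?_)
      (summable_geometric_of_lt_one (by positivity) h1)
    rw [norm_mul, Real.norm_of_nonneg (sechCoeff_nonneg hq hy _), norm_zpow, mul_pow,
      Real.norm_eq_abs, ← zpow_natCast q, ← zpow_natCast |z|]
    gcongr
    exact sechCoeff_le hq hy _
  · refine Summable.of_nonneg_of_le (fun n => norm_nonneg _) (fun n => ?_)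
      ((summable_geometric_of_lt_one (r := q / |z|) (by positivity)
        ((div_lt_one hz).2 h2)).div_const y)
    rw [norm_mul, Real.norm_of_nonneg (sechCoeff_nonneg hq hy _), norm_zpow, div_pow,
      Real.norm_eq_abs, ← zpow_natCast q, ← zpow_natCast |z|, zpow_neg |z|, div_right_comm,
      ← div_eq_mul_inv]
    gcongr
    simpa using sechCoeff_le_inv hq hy (-(n : ℤ))

/-- The coefficients of `sechSeries q y z * ∑ (-1)ʲ q ^ (j²) zʲ` as a Laurent series in `z`. -/
noncomputable def sechThetaCoeff (q y : ℝ) (n : ℤ) : ℝ :=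
  ∑' j : ℤ, sechCoeff q y (n - j) * ((-1) ^ j * q ^ (1 * j ^ 2 + 0 * j))

theorem summable_sechThetaCoeff (hq : 0 < q) (hq1 : q < 1) (hy : 0 < y) (n : ℤ) :
    Summable fun j : ℤ => sechCoeff q y (n - j) * ((-1) ^ j * q ^ (1 * j ^ 2 + 0 * j)) := by
  refine Summable.of_norm_bounded ((summable_norm_quadTheta (ε := -1) (by norm_num) hq hq1
    le_rfl 0).mul_left (1 + 1 / y)) fun j => ?_
  rw [norm_mul, Real.norm_of_nonneg (sechCoeff_nonneg hq hy _)]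
  gcongr
  exact sechCoeff_bounded hq hq1 hy _

/-- By `sechCoeff_mul` the denominators cancel in a suitable combination of the coefficients at n+1
and n, leaving Σ (-1)ʲ q^(j²+j), which vanishes. This is the Laurent coefficient form of
quasi-periodicity in z. -/
theorem sechThetaCoeff_add_one (hq : 0 < q) (hq1 : q < 1) (hy : 0 < y) (n : ℤ) :
    sechThetaCoeff q y (n + 1) = y * q ^ (2 * n + 1) * sechThetaCoeff q y n := by
  have hs := summable_sechThetaCoeff hq hq1 hy n
  have hs' : Summable fun j : ℤ => sechCoeff q y (n + 1 - (j + 1)) *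
      ((-1) ^ (j + 1) * q ^ (1 * (j + 1) ^ 2 + 0 * (j + 1))) :=
    (Equiv.addRight (1 : ℤ)).summable_iff.2 (summable_sechThetaCoeff hq hq1 hy (n + 1))
  have hshift : sechThetaCoeff q y (n + 1) = ∑' j : ℤ, sechCoeff q y (n + 1 - (j + 1)) *
      ((-1) ^ (j + 1) * q ^ (1 * (j + 1) ^ 2 + 0 * (j + 1))) := by
    unfold sechThetaCoeff
    rw [← (Equiv.addRight (1 : ℤ)).tsum_eq]
    rfl
  have key : -q ^ (-n - 1) * sechThetaCoeff q y (n + 1) + y * q ^ n * sechThetaCoeff q y n =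
      quadTheta (-1) q 1 1 := by
    rw [hshift]
    unfold sechThetaCoeff quadTheta
    rw [← tsum_mul_left, ← tsum_mul_left, ← Summable.tsum_add (hs'.mul_left _) (hs.mul_left _)]
    refine tsum_congr fun j => ?_
    rw [add_sub_add_right_eq_sub, zpow_add_one₀ (by norm_num : (-1 : ℝ) ≠ 0)]
    have e1 : q ^ (-n - 1) * q ^ (1 * (j + 1) ^ 2 + 0 * (j + 1)) =
        q ^ (-(n - j)) * q ^ (1 * j ^ 2 + 1 * j) := by
      rw [← zpow_add₀ hq.ne', ← zpow_add₀ hq.ne']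
      ring_nf
    have e2 : q ^ n * q ^ (1 * j ^ 2 + 0 * j) = q ^ (n - j) * q ^ (1 * j ^ 2 + 1 * j) := by
      rw [← zpow_add₀ hq.ne', ← zpow_add₀ hq.ne']
      ring_nf
    linear_combination sechCoeff q y (n - j) * (-1) ^ j * e1 +
      y * sechCoeff q y (n - j) * (-1) ^ j * e2 +
      (-1) ^ j * q ^ (1 * j ^ 2 + 1 * j) * sechCoeff_mul hq hy (n - j)
  rw [quadTheta_neg_one_self hq] at key
  have e : q ^ (2 * n + 1) * q ^ (-n - 1) = q ^ n := by
    rw [← zpow_add₀ hq.ne']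
    ring_nf
  have hp : 0 < q ^ (-n - 1) := by positivity
  apply mul_left_cancel₀ hp.ne'
  linear_combination -key - y * sechThetaCoeff q y n * e

theorem sechThetaCoeff_eq (hq : 0 < q) (hq1 : q < 1) (hy : 0 < y) (n : ℤ) :
    sechThetaCoeff q y n = y ^ n * q ^ (n ^ 2) * sechThetaCoeff q y 0 := by
  have step (m : ℤ) : y ^ (m + 1) * q ^ ((m + 1) ^ 2) =
      y * q ^ (2 * m + 1) * (y ^ m * q ^ (m ^ 2)) := by
    rw [zpow_add_one₀ hy.ne', show (m + 1) ^ 2 = m ^ 2 + (2 * m + 1) by ring, zpow_add₀ hq.ne']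
    ring
  induction n using Int.induction_on with
  | zero => simp
  | succ n ih => rw [sechThetaCoeff_add_one hq hq1 hy, ih, step]; ring
  | pred n ih =>
    have h1 := sechThetaCoeff_add_one hq hq1 hy (-(n : ℤ) - 1)
    have h2 := step (-(n : ℤ) - 1)
    rw [sub_add_cancel] at h1 h2
    have hp : 0 < y * q ^ (2 * (-(n : ℤ) - 1) + 1) := by positivity
    apply mul_left_cancel₀ hp.ne'
    rw [← h1, ih, h2]
    ring

/-- A case of Kronecker's formula for a quotient of theta functions. -/
theorem sechSeries_mul_theta (hq : 0 < q) (hq1 : q < 1) (hy : 0 < y) (h1 : q * |z| < 1)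
    (h2 : q < |z|) (ht : Summable fun j : ℤ => ‖(-1) ^ j * q ^ (1 * j ^ 2 + 0 * j) * z ^ j‖) :
    sechSeries q y z * ∑' j : ℤ, (-1) ^ j * q ^ (1 * j ^ 2 + 0 * j) * z ^ j =
      sechThetaCoeff q y 0 * ∑' n : ℤ, q ^ (n ^ 2) * y ^ n * z ^ n := by
  have hz : z ≠ 0 := by
    rintro rfl
    simp at h2
    linarith
  have hs := summable_norm_sechSeries hq hy h1 h2
  have hprod := summable_mul_of_summable_norm hs ht
  -- Collects the terms of the double series by the total power of z.
  let e : ℤ × ℤ ≃ ℤ × ℤ :=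
    ⟨fun x => (x.1 - x.2, x.2), fun x => (x.1 + x.2, x.2), fun x => by simp, fun x => by simp⟩
  unfold sechSeries
  rw [tsum_mul_tsum_of_summable_norm hs ht, ← e.tsum_eq, ← tsum_mul_left]
  refine (Summable.tsum_prod (e.summable_iff.2 hprod)).trans ?_
  refine tsum_congr fun n => ?_
  have h3 := sechThetaCoeff_eq hq hq1 hy n
  rw [show sechThetaCoeff q y 0 * (q ^ (n ^ 2) * y ^ n * z ^ n) = sechThetaCoeff q y n * z ^ n by
    rw [h3]; ring, sechThetaCoeff, ← tsum_mul_right]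
  refine tsum_congr fun j => ?_
  simp only [e, Function.comp_apply, Equiv.coe_fn_mk]
  rw [zpow_sub₀ hz]
  field_simp

theorem sechSeries_eq_even_add_odd (hq : 0 < q) (hq1 : q < 1) (hz : z ^ 2 = 1) :
    sechSeries q 1 z = sechSeries (q ^ 2) 1 1 + z * q * sechSeries (q ^ 2) (q ^ 2) 1 := by
  have hz0 : z ≠ 0 := by rintro rfl; norm_num at hz
  have habs : |z| = 1 := by simpa using abs_zpow_of_sq_eq_one hz 1
  have h2 (m : ℤ) : z ^ (2 * m) = 1 := by
    rw [zpow_mul, show z ^ (2 : ℤ) = 1 by exact_mod_cast hz, one_zpow]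
  have hpow (m : ℤ) : (q ^ 2) ^ m = q ^ (2 * m) := by
    rw [zpow_mul]
    norm_cast
  unfold sechSeries
  rw [tsum_int_eq_even_add_odd (summable_norm_sechSeries hq one_pos (by rwa [habs, mul_one])
    (by rwa [habs])).of_norm, ← tsum_mul_left]
  congr 1 <;> refine tsum_congr fun m => ?_
  · rw [h2, one_zpow]
    simp only [sechCoeff, hpow]
  · rw [zpow_add_one₀ hz0, h2, one_zpow]
    simp only [sechCoeff, hpow]
    rw [show 2 * (2 * m + 1) = 2 * (2 * m) + 2 by ring, zpow_add₀ hq.ne' (2 * (2 * m)),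
      zpow_add_one₀ hq.ne']
    norm_cast
    ring

theorem sechSeries_one_mul {ε : ℝ} (hε : ε ^ 2 = 1) (hq : 0 < q) (hq1 : q < 1) (hy : 0 < y) :
    sechSeries q y ε * quadTheta (-ε) q 1 0 =
      sechThetaCoeff q y 0 * ∑' n : ℤ, q ^ (n ^ 2) * y ^ n * ε ^ n := by
  have habs : |ε| = 1 := by simpa using abs_zpow_of_sq_eq_one hε 1
  have e1 (j : ℤ) : (-1) ^ j * q ^ (1 * j ^ 2 + 0 * j) * ε ^ j =
      (-ε) ^ j * q ^ (1 * j ^ 2 + 0 * j) := by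
    rw [mul_right_comm, ← mul_zpow, neg_one_mul]
  rw [← sechSeries_mul_theta hq hq1 hy (by rwa [habs, mul_one]) (by rwa [habs])]
  · simp only [e1]
    rfl
  · simp only [e1]
    exact summable_norm_quadTheta (by rw [neg_sq, hε]) hq hq1 le_rfl 0

theorem sechSeries_one_eq {ε : ℝ} (hε : ε ^ 2 = 1) (hq : 0 < q) (hq1 : q < 1) :
    sechSeries q 1 ε * quadTheta (-ε) q 1 0 = sechThetaCoeff q 1 0 * quadTheta ε q 1 0 := by
  rw [sechSeries_one_mul hε hq hq1 one_pos]
  congr 1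
  refine tsum_congr fun n => ?_
  rw [one_zpow, mul_one, mul_comm]
  ring_nf

theorem tendsto_sechSeries :
    Filter.Tendsto (fun q => sechSeries q 1 1) (nhdsWithin 0 (Set.Ioo 0 1)) (nhds (1 / 2)) := by
  refine tendsto_tsum_of_le_pow_natAbs (fun q hq n _ => ?_) (fun q hq => ?_)
  · rw [one_zpow, mul_one, abs_of_nonneg (sechCoeff_nonneg hq.1 one_pos n), ← zpow_natCast q,
      Int.natCast_natAbs]
    rcases abs_choice n with h | h <;> rw [h]
    · exact sechCoeff_le hq.1 one_pos n
    · simpa using sechCoeff_le_inv hq.1 one_pos n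
  · norm_num [sechCoeff]

/-- Kronecker's formula at z = 1 and z = -1 has the same unknown constant, which is eliminated. -/
theorem sechSeries_neg_one_mul (hq : 0 < q) (hq1 : q < 1) :
    sechSeries q 1 (-1) * quadTheta 1 q 1 0 ^ 2 = sechSeries q 1 1 * quadTheta (-1) q 1 0 ^ 2 := by
  have h1 := sechSeries_one_eq (ε := 1) (by norm_num) hq hq1
  have h2 := sechSeries_one_eq (ε := -1) (by norm_num) hq hq1
  rw [neg_neg] at h2
  linear_combination quadTheta 1 q 1 0 * h2 - quadTheta (-1) q 1 0 * h1

/-- Jacobi's two squares theorem as an identity of series. -/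
theorem sechSeries_one_one (hq : 0 < q) (hq1 : q < 1) :
    sechSeries q 1 1 = quadTheta 1 q 1 0 ^ 2 / 2 := by
  have hlim : Filter.Tendsto (fun q => sechSeries q 1 1 / quadTheta 1 q 1 0 ^ 2)
      (nhdsWithin 0 (Set.Ioo 0 1)) (nhds (1 / 2 / 1 ^ 2)) :=
    tendsto_sechSeries.div ((tendsto_quadTheta (ε := 1) (a := 1) (b := 0) (by norm_num)
      (by norm_num)).pow 2) (by norm_num)
  have := eq_of_eq_sq hlim (fun x ⟨hx0, hx1⟩ => ?_) hq hq1
  · have hp := quadTheta_one_pos hq hq1 le_rfl 0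
    rw [div_eq_iff (by positivity)] at this
    rw [this]
    ring
  · have hp := quadTheta_one_pos hx0 hx1 le_rfl 0
    have hp2 := quadTheta_one_pos (q := x ^ 2) (by positivity) (pow_lt_one₀ hx0.le hx1 two_ne_zero)
      le_rfl 0
    have t1 := quadTheta_sq_eq (ε := 1) (by norm_num) hx0 hx1
    have t2 := quadTheta_sq_eq (ε := -1) (by norm_num) hx0 hx1
    have s1 := sechSeries_eq_even_add_odd (z := 1) hx0 hx1 (by norm_num)
    have s2 := sechSeries_eq_even_add_odd (z := -1) hx0 hx1 (by norm_num)
    have s3 := sechSeries_neg_one_mul hx0 hx1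
    rw [div_eq_div_iff (by positivity) (by positivity)]
    -- Adding the cases ±x removes the odd parts of both the series and the squared theta series.
    -- Since s3 makes the two proportional, their ratio is the same at x and x².
    linear_combination (-1 / 2) * sechSeries x 1 1 * (t1 + t2) +
      (1 / 2) * quadTheta 1 x 1 0 ^ 2 * (s1 + s2) - s3 / 2

/-- This is the odd half of the two squares identity, obtained by subtracting its even half at q².
-/
theorem sechSeries_self_one (hq : 0 < q) (hq1 : q < 1) :
    sechSeries (q ^ 2) (q ^ 2) 1 = quadTheta 1 (q ^ 2) 1 1 ^ 2 / 2 := by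
  have h1 := sechSeries_one_one hq hq1
  have h2 := sechSeries_one_one (q := q ^ 2) (by positivity) (pow_lt_one₀ hq.le hq1 two_ne_zero)
  have s1 := sechSeries_eq_even_add_odd (z := 1) hq hq1 (by norm_num)
  have t1 := quadTheta_sq_eq (ε := 1) (by norm_num) hq hq1
  apply mul_left_cancel₀ hq.ne'
  linear_combination -s1 + h1 - h2 + t1 / 2

/-- The constant in Kronecker's formula for y = q² is read off at z = 1, where the series is already
known. -/
theorem sechThetaCoeff_self_zero (hq : 0 < q) (hq1 : q < 1) :
    sechThetaCoeff (q ^ 2) (q ^ 2) 0 = quadTheta 1 (q ^ 2) 1 1 * quadTheta (-1) (q ^ 2) 1 0 / 2 := by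
  have hq20 : 0 < q ^ 2 := by positivity
  have hq21 : q ^ 2 < 1 := pow_lt_one₀ hq.le hq1 two_ne_zero
  have h := sechSeries_one_mul (ε := 1) (y := q ^ 2) (by norm_num) hq20 hq21 hq20
  have ht : ∑' n : ℤ, (q ^ 2) ^ (n ^ 2) * (q ^ 2) ^ n * 1 ^ n = quadTheta 1 (q ^ 2) 1 1 := by
    refine tsum_congr fun n => ?_
    rw [one_zpow, mul_one, one_mul, one_mul, one_mul, zpow_add₀ hq20.ne']
  rw [ht, sechSeries_self_one hq hq1] at h
  have hp := quadTheta_one_pos hq20 hq21 le_rfl 1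
  apply mul_right_cancel₀ hp.ne'
  linear_combination -h

/-- The series that counts the representations of odd numbers by the form `x² + 2 y²`. -/
theorem mul_sechSeries_self (hq : 0 < q) (hq1 : q < 1) :
    q * sechSeries (q ^ 2) (q ^ 2) q = quadTheta 1 (q ^ 2) 1 1 * quadTheta 1 q 1 0 / 2 := by
  have hq20 : 0 < q ^ 2 := by positivity
  have hq21 : q ^ 2 < 1 := pow_lt_one₀ hq.le hq1 two_ne_zero
  have e1 (j : ℤ) : (-1) ^ j * (q ^ 2) ^ (1 * j ^ 2 + 0 * j) * q ^ j =
      (-1) ^ j * q ^ (2 * j ^ 2 + 1 * j) := by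
    rw [← zpow_natCast q 2, ← zpow_mul, mul_assoc, ← zpow_add₀ hq.ne']
    push_cast
    ring_nf
  -- The point z = q lies in the annulus q² < |z| < q⁻². There the two theta series become ψ(-q)
  -- and, after a shift, ψ(q)/q; `quadTheta_cross` then allows ψ(-q) to be cancelled.
  have h := sechSeries_mul_theta (z := q) (y := q ^ 2) hq20 hq21 hq20
    (by rw [abs_of_pos hq]; nlinarith) (by rw [abs_of_pos hq]; nlinarith)
    (by simp only [e1]; exact summable_norm_quadTheta (by norm_num) hq hq1 one_le_two 1)
  have ht : ∑' n : ℤ, (q ^ 2) ^ (n ^ 2) * (q ^ 2) ^ n * q ^ n = quadTheta 1 q 2 3 := by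
    refine tsum_congr fun n => ?_
    rw [← zpow_natCast q 2, ← zpow_mul, ← zpow_mul, ← zpow_add₀ hq.ne', ← zpow_add₀ hq.ne',
      one_zpow, one_mul]
    push_cast
    ring_nf
  have hs := quadTheta_shift (ε := 1) (by norm_num) hq 2 (-1)
  rw [quadTheta_neg (by norm_num), one_mul, show (2 : ℤ) + -1 = 1 by norm_num, zpow_one,
    show (-1 : ℤ) + 2 * 2 = 3 by norm_num] at hs
  simp only [e1] at h
  change _ * quadTheta (-1) q 2 1 = _ at h
  rw [ht, sechThetaCoeff_self_zero hq hq1] at h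
  have hp := quadTheta_neg_one_two_one_pos hq hq1
  apply mul_right_cancel₀ hp.ne'
  linear_combination q * h - quadTheta 1 (q ^ 2) 1 1 * quadTheta_cross hq hq1 / 2 -
    quadTheta 1 (q ^ 2) 1 1 * quadTheta (-1) (q ^ 2) 1 0 / 2 * hs

end SechSeries

/-! ### Gauss's transformation and the arithmetic-geometric mean -/

/-- The integral `∫ dθ / √(a² cos² θ + b² sin² θ)` over a quarter period. -/
noncomputable def gaussIntegral (a b : ℝ) : ℝ :=
  ∫ θ in (0 : ℝ)..(Real.pi / 2), 1 / √(a ^ 2 * Real.cos θ ^ 2 + b ^ 2 * Real.sin θ ^ 2)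

section GaussIntegral

open Real

variable {a b : ℝ}

theorem gauss_radicand_pos (ha : 0 < a) (hb : 0 < b) (θ : ℝ) :
    0 < a ^ 2 * cos θ ^ 2 + b ^ 2 * sin θ ^ 2 := by
  rcases eq_or_ne (sin θ) 0 with h | h
  · have := sin_sq_add_cos_sq θ
    rw [h] at this ⊢
    have h2 : cos θ ^ 2 = 1 := by linarith
    rw [h2]
    positivity
  · positivity

theorem continuous_gauss (ha : 0 < a) (hb : 0 < b) :
    Continuous fun θ => 1 / √(a ^ 2 * cos θ ^ 2 + b ^ 2 * sin θ ^ 2) :=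
  continuous_const.div (by fun_prop) fun θ => (sqrt_pos.2 (gauss_radicand_pos ha hb θ)).ne'

theorem gauss_denom_pos (ha : 0 < a) (hb : 0 < b) (θ : ℝ) :
    0 < a * cos θ ^ 2 + b * sin θ ^ 2 := by
  have := gauss_radicand_pos (sqrt_pos.2 ha) (sqrt_pos.2 hb) θ
  rwa [sq_sqrt ha.le, sq_sqrt hb.le] at this

/-- The change of variables in Gauss's transformation:
`gaussSubst a b θ = θ + arctan (b / a * tan θ)` for small `θ`. -/
noncomputable def gaussSubst (a b θ : ℝ) : ℝ :=
  2 * θ - arctan ((a - b) * sin θ * cos θ / (a * cos θ ^ 2 + b * sin θ ^ 2))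

theorem gauss_sq_add_sq (a b θ : ℝ) :
    ((a - b) * sin θ * cos θ) ^ 2 + (a * cos θ ^ 2 + b * sin θ ^ 2) ^ 2 =
      a ^ 2 * cos θ ^ 2 + b ^ 2 * sin θ ^ 2 := by
  have h := sin_sq_add_cos_sq θ
  linear_combination (a ^ 2 * cos θ ^ 2 + b ^ 2 * sin θ ^ 2) * h

/-- The arctangent in `gaussSubst` is θ - arctan(b/a tan θ) with its argument rewritten over a
denominator that never vanishes, so differentiability persists at θ = π/2. -/
theorem hasDerivAt_gaussSubst (ha : 0 < a) (hb : 0 < b) (θ : ℝ) :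
    HasDerivAt (gaussSubst a b) (1 + a * b / (a ^ 2 * cos θ ^ 2 + b ^ 2 * sin θ ^ 2)) θ := by
  have hd := gauss_denom_pos ha hb θ
  have hr := gauss_radicand_pos ha hb θ
  have hs := hasDerivAt_sin θ
  have hc := hasDerivAt_cos θ
  have hN := (hs.const_mul (a - b)).mul hc
  have hD := ((hc.pow 2).const_mul a).add ((hs.pow 2).const_mul b)
  have h := ((hasDerivAt_id θ).const_mul 2).sub (hN.div hD hd.ne').arctan
  refine h.congr_deriv ?_
  have h1 := gauss_sq_add_sq a b θ
  have hsc := sin_sq_add_cos_sq θ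
  have h3 : 1 + ((a - b) * sin θ * cos θ / (a * cos θ ^ 2 + b * sin θ ^ 2)) ^ 2 =
      (a ^ 2 * cos θ ^ 2 + b ^ 2 * sin θ ^ 2) / (a * cos θ ^ 2 + b * sin θ ^ 2) ^ 2 := by
    rw [← h1]
    field_simp
    ring
  simp only [Pi.mul_apply, Pi.add_apply, Pi.div_apply, Pi.pow_apply, h3]
  field_simp
  push_cast
  linear_combination (a * b * (sin θ ^ 2 + cos θ ^ 2 + 1) -
    (a ^ 2 * cos θ ^ 2 + b ^ 2 * sin θ ^ 2)) * hsc

/-- Let R be the old radicand. By `gauss_sq_add_sq`, √R is the hypotenuse of the triangle defining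
the arctangent, so the cosine of the new angle is (a cos² θ - b sin² θ)/√R. -/
theorem gauss_subst_radicand (ha : 0 < a) (hb : 0 < b) (θ : ℝ) :
    ((a + b) / 2) ^ 2 * cos (gaussSubst a b θ) ^ 2 + (a * b) * sin (gaussSubst a b θ) ^ 2 =
      ((a + b) * (a * cos θ ^ 2 + b * sin θ ^ 2)) ^ 2 /
        (4 * (a ^ 2 * cos θ ^ 2 + b ^ 2 * sin θ ^ 2)) := by
  have hd := gauss_denom_pos ha hb θ
  have hr := gauss_radicand_pos ha hb θ
  have h1 := gauss_sq_add_sq a b θ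
  have hsc := sin_sq_add_cos_sq θ
  set D := a * cos θ ^ 2 + b * sin θ ^ 2 with hD
  set R := a ^ 2 * cos θ ^ 2 + b ^ 2 * sin θ ^ 2 with hR
  have hw : √(1 + ((a - b) * sin θ * cos θ / D) ^ 2) = √R / D := by
    rw [show 1 + ((a - b) * sin θ * cos θ / D) ^ 2 = R / D ^ 2 by rw [← h1]; field_simp; ring,
      sqrt_div hr.le, sqrt_sq hd.le]
  have hRs : √R ^ 2 = R := sq_sqrt hr.le
  have hRp : 0 < √R := sqrt_pos.2 hr
  have hcos : cos (gaussSubst a b θ) ^ 2 = (a * cos θ ^ 2 - b * sin θ ^ 2) ^ 2 / R := by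
    rw [gaussSubst, cos_sub, cos_arctan, sin_arctan, ← hD, hw, cos_two_mul, sin_two_mul]
    rw [show (2 * cos θ ^ 2 - 1) * (1 / (√R / D)) + 2 * sin θ * cos θ *
      ((a - b) * sin θ * cos θ / D / (√R / D)) = ((2 * cos θ ^ 2 - 1) * D + 2 * sin θ * cos θ *
      ((a - b) * sin θ * cos θ)) / √R by field_simp, div_pow, hRs]
    congr 2
    rw [hD]
    have : sin θ ^ 2 = 1 - cos θ ^ 2 := by linarith
    ring_nf
    simp only [this]
    ring
  rw [sin_sq, hcos]
  field_simp
  rw [hD, hR]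
  have : sin θ ^ 2 = 1 - cos θ ^ 2 := by linarith
  simp only [this]
  ring

theorem integral_zero_pi_gauss (ha : 0 < a) (hb : 0 < b) :
    ∫ θ in (0 : ℝ)..π, 1 / √(a ^ 2 * cos θ ^ 2 + b ^ 2 * sin θ ^ 2) = 2 * gaussIntegral a b := by
  have hi (c d : ℝ) := (continuous_gauss ha hb).intervalIntegrable (μ := MeasureTheory.volume) c d
  rw [← intervalIntegral.integral_add_adjacent_intervals (hi 0 (π / 2)) (hi (π / 2) π), two_mul,
    gaussIntegral]
  congr 1
  have := intervalIntegral.integral_comp_sub_left (a := 0) (b := π / 2)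
    (fun θ => 1 / √(a ^ 2 * cos θ ^ 2 + b ^ 2 * sin θ ^ 2)) π
  rw [sub_zero, sub_half] at this
  rw [← this]
  simp only [cos_pi_sub, sin_pi_sub, neg_sq]

/-- Gauss's transformation. -/
theorem gaussIntegral_agm (ha : 0 < a) (hb : 0 < b) :
    gaussIntegral ((a + b) / 2) (√(a * b)) = gaussIntegral a b := by
  have ha1 : 0 < (a + b) / 2 := by positivity
  have hb1 : 0 < √(a * b) := by positivity
  -- As θ covers [0, π/2] the new angle covers [0, π], giving twice the quarter-period integral; the
  -- transformed integrand is also twice the original, so the factors cancel.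
  have h := intervalIntegral.integral_comp_mul_deriv (a := 0) (b := π / 2)
    (fun θ _ => hasDerivAt_gaussSubst ha hb θ)
    (Continuous.continuousOn (continuous_const.add (continuous_const.div (by fun_prop)
      fun θ => (gauss_radicand_pos ha hb θ).ne'))) (continuous_gauss ha1 hb1)
  have h0 : gaussSubst a b 0 = 0 := by simp [gaussSubst]
  have h1 : gaussSubst a b (π / 2) = π := by
    simp [gaussSubst]
    ring
  rw [h0, h1, integral_zero_pi_gauss ha1 hb1] at h
  have hpt : ∀ θ, ((fun θ => 1 / √(((a + b) / 2) ^ 2 * cos θ ^ 2 + √(a * b) ^ 2 * sin θ ^ 2)) ∘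
      gaussSubst a b) θ * (1 + a * b / (a ^ 2 * cos θ ^ 2 + b ^ 2 * sin θ ^ 2)) =
      2 * (1 / √(a ^ 2 * cos θ ^ 2 + b ^ 2 * sin θ ^ 2)) := by
    intro θ
    have hd := gauss_denom_pos ha hb θ
    have hr := gauss_radicand_pos ha hb θ
    have hsc := sin_sq_add_cos_sq θ
    simp only [Function.comp_apply]
    rw [sq_sqrt (by positivity), gauss_subst_radicand ha hb, sqrt_div (by positivity),
      sqrt_sq (by positivity), sqrt_mul (by norm_num), show √(4 : ℝ) = 2 by
        rw [show (4 : ℝ) = 2 ^ 2 by norm_num]; exact sqrt_sq (by norm_num)]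
    have key : a ^ 2 * cos θ ^ 2 + b ^ 2 * sin θ ^ 2 + a * b =
        (a + b) * (a * cos θ ^ 2 + b * sin θ ^ 2) := by
      linear_combination (-a * b) * hsc
    rw [one_add_div hr.ne', key]
    have hRs := sq_sqrt hr.le
    have hRp := sqrt_pos.2 hr
    set D := a * cos θ ^ 2 + b * sin θ ^ 2
    set R := a ^ 2 * cos θ ^ 2 + b ^ 2 * sin θ ^ 2
    have hab : 0 < a + b := by positivity
    field_simp
    linarith
  simp only [hpt] at h
  rw [intervalIntegral.integral_const_mul] at h
  simp only [gaussIntegral] at h ⊢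
  linarith

theorem gaussIntegral_mem_Icc (hb : 0 < b) (hba : b ≤ a) :
    gaussIntegral a b ∈ Set.Icc (π / 2 / a) (π / 2 / b) := by
  have ha : 0 < a := hb.trans_le hba
  have hi := (continuous_gauss ha hb).intervalIntegrable (μ := MeasureTheory.volume) 0 (π / 2)
  have hc (c : ℝ) : ∫ θ in (0 : ℝ)..(π / 2), 1 / c = π / 2 / c := by
    rw [intervalIntegral.integral_const, sub_zero, smul_eq_mul, mul_one_div]
  have hsq : b ^ 2 ≤ a ^ 2 := by gcongr
  constructor
  · rw [← hc]
    refine intervalIntegral.integral_mono_on (by positivity) (by simp) hi fun θ _ => ?_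
    apply one_div_le_one_div_of_le (sqrt_pos.2 (gauss_radicand_pos ha hb θ))
    refine sqrt_le_iff.2 ⟨ha.le, ?_⟩
    nlinarith [sin_sq_add_cos_sq θ, sq_nonneg (sin θ)]
  · rw [← hc]
    refine intervalIntegral.integral_mono_on (by positivity) hi (by simp) fun θ _ => ?_
    apply one_div_le_one_div_of_le hb
    refine le_sqrt_of_sq_le ?_
    nlinarith [sin_sq_add_cos_sq θ, sq_nonneg (cos θ)]

/-- The arithmetic mean of φ(q)² and φ(-q)² is φ(q²)² and their geometric mean is φ(-q²)², so the
integral is unchanged by q ↦ q². As q → 0 both arguments tend to 1. -/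
theorem gaussIntegral_quadTheta {q : ℝ} (hq0 : 0 < q) (hq1 : q < 1) :
    gaussIntegral (quadTheta 1 q 1 0 ^ 2) (quadTheta (-1) q 1 0 ^ 2) = π / 2 := by
  have hle (x : ℝ) (hx : x ∈ Set.Ioo (0 : ℝ) 1) :
      quadTheta (-1) x 1 0 ^ 2 ≤ quadTheta 1 x 1 0 ^ 2 := by
    have t1 := quadTheta_sq_eq (ε := 1) (by norm_num) hx.1 hx.2
    have t2 := quadTheta_sq_eq (ε := -1) (by norm_num) hx.1 hx.2
    have := mul_nonneg hx.1.le (sq_nonneg (quadTheta 1 (x ^ 2) 1 1))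
    linarith
  have h1 : Filter.Tendsto (fun q => π / 2 / quadTheta 1 q 1 0 ^ 2) (nhdsWithin 0 (Set.Ioo 0 1))
      (nhds (π / 2 / 1 ^ 2)) := tendsto_const_nhds.div ((tendsto_quadTheta (ε := 1) (a := 1)
      (b := 0) (by norm_num) (by norm_num)).pow 2) (by norm_num)
  have h2 : Filter.Tendsto (fun q => π / 2 / quadTheta (-1) q 1 0 ^ 2)
      (nhdsWithin 0 (Set.Ioo 0 1))
      (nhds (π / 2 / 1 ^ 2)) := tendsto_const_nhds.div ((tendsto_quadTheta (ε := -1) (a := 1)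
      (b := 0) (by norm_num) (by norm_num)).pow 2) (by norm_num)
  rw [one_pow, div_one] at h1 h2
  refine eq_of_eq_sq (f := fun q => gaussIntegral (quadTheta 1 q 1 0 ^ 2)
    (quadTheta (-1) q 1 0 ^ 2)) (tendsto_of_tendsto_of_tendsto_of_le_of_le' h1 h2 ?_ ?_)
    (fun x hx => ?_) hq0 hq1
  · filter_upwards [self_mem_nhdsWithin] with x hx
    have := quadTheta_neg_one_pos hx.1 hx.2
    exact (gaussIntegral_mem_Icc (by positivity) (hle x hx)).1
  · filter_upwards [self_mem_nhdsWithin] with x hx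
    have := quadTheta_neg_one_pos hx.1 hx.2
    exact (gaussIntegral_mem_Icc (by positivity) (hle x hx)).2
  · have p1 := quadTheta_one_pos hx.1 hx.2 le_rfl 0
    have p2 := quadTheta_neg_one_pos hx.1 hx.2
    have t1 := quadTheta_sq_eq (ε := 1) (by norm_num) hx.1 hx.2
    have t2 := quadTheta_sq_eq (ε := -1) (by norm_num) hx.1 hx.2
    rw [← gaussIntegral_agm (by positivity) (by positivity), ← mul_pow,
      quadTheta_one_mul_neg_one hx.1 hx.2, sqrt_sq (by positivity)]
    congr 1
    linarith

theorem ellipticK_complModulus_div (hb : 0 < b) (hba : b < a) :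
    ellipticK (complModulus (b / a)) = a * gaussIntegral a b := by
  have ha : 0 < a := hb.trans hba
  have h1 : b / a < 1 := (div_lt_one ha).2 hba
  have h0 : 0 < b / a := by positivity
  rw [ellipticK, gaussIntegral, ← intervalIntegral.integral_const_mul]
  congr 1
  ext θ
  rw [ellipticIntegrand, complModulus, sq_sqrt (by nlinarith)]
  have : 1 - (1 - (b / a) ^ 2) * sin θ ^ 2 =
      (a ^ 2 * cos θ ^ 2 + b ^ 2 * sin θ ^ 2) / a ^ 2 := by
    rw [cos_sq']
    field_simp
    ring
  rw [this, sqrt_div (gauss_radicand_pos ha hb θ).le, sqrt_sq ha.le]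
  field_simp

end GaussIntegral

/-! ### The modular transformation and the singular modulus -/

section Modular

open Real

theorem nome_pos (r : ℝ) : 0 < nome r := exp_pos _

theorem nome_lt_one {r : ℝ} (hr : 0 < r) : nome r < 1 := by
  have := sqrt_pos.2 hr
  exact exp_lt_one_iff.2 (neg_neg_of_pos (by positivity))

theorem exp_zpow (x : ℝ) (n : ℤ) : exp x ^ n = exp (n * x) := by
  rw [← rpow_intCast, ← exp_mul, mul_comm]

theorem quadTheta_exp_neg_inv {s : ℝ} (hs : 0 < s) :
    quadTheta 1 (exp (-(π * s⁻¹))) 1 0 = √s * quadTheta 1 (exp (-(π * s))) 1 0 := by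
  have h := Real.tsum_exp_neg_mul_int_sq (inv_pos.2 hs)
  rw [← sqrt_eq_rpow, sqrt_inv, one_div, inv_inv, div_inv_eq_mul] at h
  have e (x : ℝ) : quadTheta 1 (exp (-(π * x))) 1 0 = ∑' n : ℤ, exp (-π * x * n ^ 2) := by
    refine tsum_congr fun n => ?_
    rw [exp_zpow, one_zpow, one_mul]
    push_cast
    ring_nf
  rw [e, e, h]

theorem quadTheta_neg_one_exp_neg_inv {s : ℝ} (hs : 0 < s) :
    quadTheta (-1) (exp (-(π * s⁻¹))) 1 0 =
      √s * (exp (-(π * s / 4)) * quadTheta 1 (exp (-(π * s))) 1 1) := by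
  -- The linear coefficient I/2 produces exp(πin) = (-1)ⁿ and moves the dual lattice by 1/2; (n -
  -- 1/2)² = n² - n + 1/4 accounts for the factor exp(-πs/4).
  have h := Complex.tsum_exp_neg_quadratic (a := (s⁻¹ : ℝ)) (by simpa using hs) (Complex.I / 2)
  have e1 (n : ℤ) : Complex.exp (-π * (s⁻¹ : ℝ) * n ^ 2 + 2 * π * (Complex.I / 2) * n) =
      (((-1) ^ n * exp (-(π * s⁻¹)) ^ (1 * n ^ 2 + 0 * n) : ℝ) : ℂ) := by
    rw [Complex.exp_add, exp_zpow,
      show 2 * (π : ℂ) * (Complex.I / 2) * n = n * (π * Complex.I) by ring, Complex.exp_int_mul,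
      Complex.exp_pi_mul_I, mul_comm]
    push_cast
    ring_nf
  have e2 (n : ℤ) : Complex.exp (-π / (s⁻¹ : ℝ) * (n + Complex.I * (Complex.I / 2)) ^ 2) =
      ((exp (-(π * s / 4)) * (1 ^ n * exp (-(π * s)) ^ (1 * n ^ 2 + (-1) * n)) : ℝ) : ℂ) := by
    rw [exp_zpow, one_zpow, one_mul, ← exp_add, Complex.ofReal_exp, ← mul_div_assoc,
      Complex.I_mul_I]
    congr 1
    push_cast
    rw [div_inv_eq_mul]
    ring
  have e3 : (1 : ℂ) / ((s⁻¹ : ℝ) : ℂ) ^ (1 / 2 : ℂ) = (√s : ℝ) := by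
    rw [show (1 / 2 : ℂ) = ((1 / 2 : ℝ) : ℂ) by push_cast; rfl,
      ← Complex.ofReal_cpow (inv_pos.2 hs).le, ← sqrt_eq_rpow, sqrt_inv]
    push_cast
    rw [one_div, inv_inv]
  simp only [e1, e2, e3] at h
  rw [← Complex.ofReal_tsum, ← Complex.ofReal_tsum, ← Complex.ofReal_mul, Complex.ofReal_inj,
    tsum_mul_left] at h
  rw [← quadTheta_neg (by norm_num) _ 1 1]
  exact h

/-- Jacobi's quartic identity: (A+B)² - (A-B)² = 4AB with A ± B = φ(±q)². It amounts to k² + k'² =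
1. -/
theorem quadTheta_quartic {q : ℝ} (hq0 : 0 < q) (hq1 : q < 1) :
    quadTheta 1 q 1 0 ^ 4 = quadTheta (-1) q 1 0 ^ 4 + q * quadTheta 1 q 1 1 ^ 4 := by
  have t1 := quadTheta_sq_eq (ε := 1) (by norm_num) hq0 hq1
  have t2 := quadTheta_sq_eq (ε := -1) (by norm_num) hq0 hq1
  have t3 := quadTheta_one_one_sq hq0 hq1
  rw [show quadTheta 1 q 1 0 ^ 4 = (quadTheta 1 q 1 0 ^ 2) ^ 2 by ring,
    show quadTheta (-1) q 1 0 ^ 4 = (quadTheta (-1) q 1 0 ^ 2) ^ 2 by ring,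
    show quadTheta 1 q 1 1 ^ 4 = (quadTheta 1 q 1 1 ^ 2) ^ 2 by ring, t1, t2, t3]
  ring

theorem quadTheta_neg_one_lt {q : ℝ} (hq0 : 0 < q) (hq1 : q < 1) :
    quadTheta (-1) q 1 0 ^ 2 < quadTheta 1 q 1 0 ^ 2 := by
  have t := quadTheta_quartic hq0 hq1
  have h1 := quadTheta_one_pos hq0 hq1 le_rfl 1
  refine lt_of_pow_lt_pow_left₀ 2 (by positivity) ?_
  have : 0 < q * quadTheta 1 q 1 1 ^ 4 := by positivity
  linarith

theorem ellipticK_complModulus_quadTheta {q : ℝ} (hq0 : 0 < q) (hq1 : q < 1) :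
    ellipticK (complModulus (quadTheta (-1) q 1 0 ^ 2 / quadTheta 1 q 1 0 ^ 2)) =
      quadTheta 1 q 1 0 ^ 2 * (π / 2) := by
  have := quadTheta_neg_one_pos hq0 hq1
  rw [ellipticK_complModulus_div (by positivity) (quadTheta_neg_one_lt hq0 hq1),
    gaussIntegral_quadTheta hq0 hq1]

theorem complModulus_quadTheta {q : ℝ} (hq0 : 0 < q) (hq1 : q < 1) :
    complModulus (quadTheta (-1) q 1 0 ^ 2 / quadTheta 1 q 1 0 ^ 2) =
      √q * quadTheta 1 q 1 1 ^ 2 / quadTheta 1 q 1 0 ^ 2 := by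
  have h := quadTheta_one_pos hq0 hq1 le_rfl 0
  have t := quadTheta_quartic hq0 hq1
  have h1 := quadTheta_one_pos hq0 hq1 le_rfl 1
  rw [complModulus, sqrt_eq_iff_mul_self_eq_of_pos (by positivity),
    ← sq, div_pow, div_pow, mul_pow, sq_sqrt hq0.le]
  field_simp
  linear_combination -t

theorem sqrt_nome (r : ℝ) : √(nome r) = exp (-(π * √r / 2)) := by
  rw [nome, ← exp_half]
  ring_nf

/-- The singular modulus and the complete elliptic integral in terms of theta series. -/
theorem isSingularModulus_quadTheta {r : ℝ} (hr : 0 < r) :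
    IsSingularModulus r
      (√(nome r) * quadTheta 1 (nome r) 1 1 ^ 2 / quadTheta 1 (nome r) 1 0 ^ 2) := by
  have hs := sqrt_pos.2 hr
  have hq0 := nome_pos r
  have hq1 := nome_lt_one hr
  have hφ := quadTheta_one_pos hq0 hq1 le_rfl 0
  have hφ' := quadTheta_neg_one_pos hq0 hq1
  have hk' := (div_lt_one (by positivity)).2 (quadTheta_neg_one_lt hq0 hq1)
  obtain ⟨h0, h1⟩ := complModulus_mem (by positivity) hk'
  have hK := ellipticK_complModulus_quadTheta hq0 hq1
  rw [complModulus_quadTheta hq0 hq1] at h0 h1 hK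
  refine ⟨h0, h1, ?_⟩
  have hi1 : exp (-(π * (√r)⁻¹)) < 1 := exp_lt_one_iff.2 (neg_neg_of_pos (by positivity))
  -- At the nome exp(-π/√r) the quotient φ(-q)²/φ(q)² equals, by Poisson summation, the modulus k
  -- belonging to `nome r`. So this evaluates K(k') with the extra factor √r.
  have hK' := ellipticK_complModulus_quadTheta (exp_pos (-(π * (√r)⁻¹))) hi1
  rw [quadTheta_neg_one_exp_neg_inv hs, quadTheta_exp_neg_inv hs] at hK'
  change ellipticK (complModulus ((√√r * (exp (-(π * √r / 4)) * quadTheta 1 (nome r) 1 1)) ^ 2 /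
    (√√r * quadTheta 1 (nome r) 1 0) ^ 2)) = (√√r * quadTheta 1 (nome r) 1 0) ^ 2 * (π / 2) at hK'
  have e : (√√r * (exp (-(π * √r / 4)) * quadTheta 1 (nome r) 1 1)) ^ 2 /
      (√√r * quadTheta 1 (nome r) 1 0) ^ 2 =
      √(nome r) * quadTheta 1 (nome r) 1 1 ^ 2 / quadTheta 1 (nome r) 1 0 ^ 2 := by
    have : exp (-(π * √r / 4)) ^ 2 = √(nome r) := by
      rw [sqrt_nome, ← exp_nat_mul]
      push_cast
      ring_nf
    rw [mul_pow, mul_pow, mul_pow, this, mul_div_mul_left _ _ (by positivity)]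
  rw [e] at hK'
  rw [hK, hK', mul_pow, sq_sqrt hs.le]
  field_simp

theorem singularModulus_eq {r : ℝ} (hr : 0 < r) :
    singularModulus r =
      √(nome r) * quadTheta 1 (nome r) 1 1 ^ 2 / quadTheta 1 (nome r) 1 0 ^ 2 :=
  (existsUnique_isSingularModulus hr).unique (singularModulus_spec hr)
    (isSingularModulus_quadTheta hr)

theorem complModulus_singularModulus {r : ℝ} (hr : 0 < r) :
    complModulus (singularModulus r) =
      quadTheta (-1) (nome r) 1 0 ^ 2 / quadTheta 1 (nome r) 1 0 ^ 2 := by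
  have hq0 := nome_pos r
  have hq1 := nome_lt_one hr
  have hφ := quadTheta_one_pos hq0 hq1 le_rfl 0
  have hφ' := quadTheta_neg_one_pos hq0 hq1
  rw [singularModulus_eq hr, ← complModulus_quadTheta hq0 hq1, complModulus_complModulus
    (by positivity) ((div_lt_one (by positivity)).2 (quadTheta_neg_one_lt hq0 hq1))]

theorem ellipticK_singularModulus {r : ℝ} (hr : 0 < r) :
    ellipticK (singularModulus r) = quadTheta 1 (nome r) 1 0 ^ 2 * (π / 2) := by
  have hq0 := nome_pos r
  have hq1 := nome_lt_one hr
  rw [singularModulus_eq hr, ← complModulus_quadTheta hq0 hq1,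
    ellipticK_complModulus_quadTheta hq0 hq1]

/-- `K k / (√2 π √(1 + k'))` as a product of theta series. -/
theorem ellipticK_mul_singularModulus_div {r : ℝ} (hr : 0 < r) :
    ellipticK (singularModulus r) * singularModulus r /
        (√2 * π * √(1 + complModulus (singularModulus r))) =
      √(nome r) * (quadTheta 1 (nome r ^ 2) 1 1 * quadTheta 1 (nome r) 1 0 / 2) := by
  have hq0 := nome_pos r
  have hq1 := nome_lt_one hr
  rw [ellipticK_singularModulus hr, complModulus_singularModulus hr, singularModulus_eq hr]
  set q := nome r
  have hφ := quadTheta_one_pos hq0 hq1 le_rfl 0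
  have hφ2 := quadTheta_one_pos (q := q ^ 2) (by positivity) (pow_lt_one₀ hq0.le hq1 two_ne_zero)
    le_rfl 0
  have t1 := quadTheta_sq_eq (ε := 1) (by norm_num) hq0 hq1
  have t2 := quadTheta_sq_eq (ε := -1) (by norm_num) hq0 hq1
  have t3 := quadTheta_one_one_sq hq0 hq1
  -- This is φ(q)² + φ(-q)² = 2φ(q²)²; it makes 1 + k' twice a square.
  have h1 : 1 + quadTheta (-1) q 1 0 ^ 2 / quadTheta 1 q 1 0 ^ 2 =
      2 * (quadTheta 1 (q ^ 2) 1 0 / quadTheta 1 q 1 0) ^ 2 := by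
    field_simp
    linarith
  rw [h1, sqrt_mul (by norm_num), sqrt_sq (by positivity), t3]
  have h2 : √2 * √2 = (2 : ℝ) := mul_self_sqrt (by norm_num)
  field_simp
  rw [sq_sqrt (by norm_num)]
  ring

end Modular

/-! ### The Lambert series -/

section LambertSeries

open Real

theorem kroneckerSym_eight (a : ℤ) : kroneckerSym a 8 = ZMod.χ₈ (a : ZMod 8) ^ 3 := by
  have h : Nat.factorization 8 2 = 3 := by
    rw [show 8 = 2 ^ 3 by norm_num, Nat.Prime.factorization_pow Nat.prime_two]
    simp
  simp [kroneckerSym, h]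

theorem kroneckerSym_add_four (a : ℤ) : kroneckerSym (a + 4) 8 = -kroneckerSym a 8 := by
  rw [kroneckerSym_eight, kroneckerSym_eight]
  push_cast
  generalize (a : ZMod 8) = x
  revert x
  decide

theorem kroneckerSym_even (a : ℤ) : kroneckerSym (2 * a) 8 = 0 := by
  rw [kroneckerSym_eight]
  push_cast
  generalize (a : ZMod 8) = x
  revert x
  decide

theorem abs_kroneckerSym_le (a : ℤ) : |(kroneckerSym a 8 : ℝ)| ≤ 1 := by
  rw [kroneckerSym_eight]
  generalize (a : ZMod 8) = x
  have : |ZMod.χ₈ x ^ 3| ≤ 1 := by revert x; decide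
  exact_mod_cast this

theorem kroneckerSym_small : kroneckerSym 2 8 = 0 ∧ kroneckerSym 3 8 = -1 ∧
    kroneckerSym 4 8 = 0 ∧ kroneckerSym 5 8 = -1 := by
  simp only [kroneckerSym_eight]
  decide

/-- By antiperiodicity the sum S satisfies S = -x - x³ - x⁴ S. -/
theorem hasSum_kroneckerSym_pow {x : ℝ} (hx0 : 0 < x) (hx1 : x < 1) :
    HasSum (fun n : ℕ => (kroneckerSym ((n : ℤ) + 2) 8 : ℝ) * x ^ n)
      (-((x + x ^ 3) / (1 + x ^ 4))) := by
  have hs : Summable fun n : ℕ => (kroneckerSym ((n : ℤ) + 2) 8 : ℝ) * x ^ n := by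
    refine Summable.of_norm_bounded (summable_geometric_of_lt_one hx0.le hx1) fun n => ?_
    rw [norm_mul, Real.norm_eq_abs, norm_of_nonneg (by positivity)]
    exact mul_le_of_le_one_left (by positivity) (abs_kroneckerSym_le _)
  have h := hs.sum_add_tsum_nat_add 4
  have h2 : ∑' n : ℕ, (kroneckerSym (((n + 4 : ℕ) : ℤ) + 2) 8 : ℝ) * x ^ (n + 4) =
      -x ^ 4 * ∑' n : ℕ, (kroneckerSym ((n : ℤ) + 2) 8 : ℝ) * x ^ n := by
    rw [← tsum_mul_left]
    refine tsum_congr fun n => ?_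
    rw [show ((n + 4 : ℕ) : ℤ) + 2 = ((n : ℤ) + 2) + 4 by push_cast; ring, kroneckerSym_add_four]
    push_cast
    ring
  obtain ⟨k2, k3, k4, k5⟩ := kroneckerSym_small
  rw [h2] at h
  norm_num [Finset.sum_range_succ, k2, k3, k4, k5] at h
  have hp : 0 < 1 + x ^ 4 := by positivity
  convert hs.hasSum using 1
  field_simp
  linarith

theorem hasSum_kroneckerSym_geometric {p : ℝ} (hp0 : 0 < p) (hp1 : p < 1) (n : ℕ) :
    HasSum (fun m : ℕ => (kroneckerSym ((n : ℤ) + 2) 8 : ℝ) * (p ^ (2 * m + 1)) ^ n)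
      ((kroneckerSym ((n : ℤ) + 2) 8 : ℝ) * (p ^ n / (1 - (p ^ 2) ^ n))) := by
  rcases Nat.eq_zero_or_pos n with rfl | hn
  -- At n = 0 the quotient divides by zero, but χ(0) = 0 makes both sides vanish.
  · simp [kroneckerSym_small.1, hasSum_zero]
  · have h1 : (p ^ 2) ^ n < 1 := pow_lt_one₀ (by positivity)
      (pow_lt_one₀ hp0.le hp1 two_ne_zero) hn.ne'
    refine HasSum.mul_left _ ?_
    rw [div_eq_mul_inv]
    convert (hasSum_geometric_of_lt_one (by positivity) h1).mul_left (p ^ n) using 1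
    ext m
    ring

theorem summable_kroneckerSym_double {p : ℝ} (hp0 : 0 < p) (hp1 : p < 1) :
    Summable fun x : ℕ × ℕ => (kroneckerSym ((x.1 : ℤ) + 2) 8 : ℝ) * (p ^ (2 * x.2 + 1)) ^ x.1 := by
  have hg := summable_geometric_of_lt_one hp0.le hp1
  refine Summable.of_norm_bounded (hg.mul_of_nonneg hg (fun n => by positivity)
    fun n => by positivity) fun ⟨n, m⟩ => ?_
  rw [norm_mul, Real.norm_eq_abs, norm_of_nonneg (by positivity)]
  rcases Nat.eq_zero_or_pos n with rfl | hn
  · simp only [Nat.cast_zero, zero_add, kroneckerSym_small.1]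
    rw [Int.cast_zero, abs_zero, zero_mul]
    positivity
  · refine (mul_le_of_le_one_left (by positivity) (abs_kroneckerSym_le _)).trans ?_
    rw [← pow_mul, ← pow_add]
    -- For n ≥ 1, (2m+1)n ≥ n + m.
    exact pow_le_pow_of_le_one hp0.le hp1.le (by nlinarith)

theorem tsum_int_eq_tsum_nat_add {f : ℤ → ℝ} (hf : Summable f) :
    ∑' n, f n = ∑' n : ℕ, (f n + f (-((n : ℤ) + 1))) := by
  have h1 : Summable fun n : ℕ => f n := hf.comp_injective Nat.cast_injective
  have h2 : Summable fun n : ℕ => f (-((n : ℤ) + 1)) :=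
    hf.comp_injective (i := fun n : ℕ => -((n : ℤ) + 1)) fun a b h => by simpa using h
  rw [tsum_of_nat_of_neg_add_one h1 h2, h1.tsum_add h2]

/-- Under m ↦ -1-m, x = p^(2m+1) becomes 1/x and x³/(1+x⁴) becomes x/(1+x⁴), so the two numerators
are the two halves of one bilateral series. -/
theorem tsum_eq_sechSeries {p : ℝ} (hp0 : 0 < p) (hp1 : p < 1) :
    ∑' m : ℕ, (p ^ (2 * m + 1) + (p ^ (2 * m + 1)) ^ 3) / (1 + (p ^ (2 * m + 1)) ^ 4) =
      p ^ 3 * sechSeries ((p ^ 2) ^ 2) ((p ^ 2) ^ 2) (p ^ 2) := by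
  have hq0 : 0 < p ^ 2 := by positivity
  have hq1 : p ^ 2 < 1 := pow_lt_one₀ hp0.le hp1 two_ne_zero
  have hs : Summable fun n : ℤ => sechCoeff ((p ^ 2) ^ 2) ((p ^ 2) ^ 2) n * (p ^ 2) ^ n :=
    (summable_norm_sechSeries (by positivity) (by positivity) (by rw [abs_of_pos hq0]; nlinarith)
      (by rw [abs_of_pos hq0]; nlinarith)).of_norm
  have hterm (n : ℤ) : p ^ 3 * (sechCoeff ((p ^ 2) ^ 2) ((p ^ 2) ^ 2) n * (p ^ 2) ^ n) =
      (p ^ (2 * n + 1)) ^ 3 / (1 + (p ^ (2 * n + 1)) ^ 4) := by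
    have e1 : (p ^ (2 * n + 1)) ^ 3 = p ^ 3 * (((p ^ 2) ^ 2) ^ n * (p ^ 2) ^ n) := by
      rw [← pow_mul, ← zpow_natCast p (2 * 2), ← zpow_natCast p 2, ← zpow_natCast p 3,
        ← zpow_natCast, ← zpow_mul, ← zpow_mul, ← zpow_mul, ← zpow_add₀ hp0.ne',
        ← zpow_add₀ hp0.ne']
      push_cast
      ring_nf
    have e2 : (p ^ (2 * n + 1)) ^ 4 = (p ^ 2) ^ 2 * ((p ^ 2) ^ 2) ^ (2 * n) := by
      rw [← pow_mul, ← zpow_natCast p (2 * 2), ← zpow_natCast _ 4, ← zpow_mul, ← zpow_mul,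
        ← zpow_add₀ hp0.ne']
      push_cast
      ring_nf
    rw [e1, e2, sechCoeff]
    ring
  rw [sechSeries, tsum_int_eq_tsum_nat_add hs, ← tsum_mul_left]
  refine tsum_congr fun m => ?_
  rw [mul_add, hterm, hterm, show 2 * -((m : ℤ) + 1) + 1 = -(2 * m + 1) by ring, zpow_neg,
    show p ^ (2 * (m : ℤ) + 1) = p ^ (2 * m + 1) by norm_cast]
  have hX : 0 < p ^ (2 * m + 1) := by positivity
  generalize p ^ (2 * m + 1) = X at hX ⊢
  field_simp
  ring

theorem hasSum_kroneckerSym_lambert {p : ℝ} (hp0 : 0 < p) (hp1 : p < 1) :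
    HasSum (fun n : ℕ => (kroneckerSym ((n : ℤ) + 2) 8 : ℝ) * (p ^ n / (1 - (p ^ 2) ^ n)))
      (-(p * (quadTheta 1 ((p ^ 2) ^ 2) 1 1 * quadTheta 1 (p ^ 2) 1 0 / 2))) := by
  have hd := summable_kroneckerSym_double hp0 hp1
  have h1 := hd.hasSum.prod_fiberwise (hasSum_kroneckerSym_geometric hp0 hp1)
  have h2 : HasSum (fun m : ℕ => -((p ^ (2 * m + 1) + (p ^ (2 * m + 1)) ^ 3) /
      (1 + (p ^ (2 * m + 1)) ^ 4))) _ :=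
    ((Equiv.prodComm ℕ ℕ).hasSum_iff.2 hd.hasSum).prod_fiberwise fun m =>
      hasSum_kroneckerSym_pow (by positivity) (pow_lt_one₀ hp0.le hp1 (by omega))
  have h3 := h2.tsum_eq
  rw [tsum_neg, tsum_eq_sechSeries hp0 hp1] at h3
  rw [← h3] at h1
  convert h1 using 1
  rw [← mul_sechSeries_self (by positivity) (pow_lt_one₀ hp0.le hp1 two_ne_zero)]
  ring

end LambertSeries

/-! ### The series in the nome, and cd₁ at K/2 -/

section Corollary

open Real

theorem rpow_nome_half (r : ℝ) (n : ℕ) : nome r ^ ((n : ℝ) / 2) = √(nome r) ^ n := by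
  rw [rpow_div_two_eq_sqrt _ (nome_pos r).le, rpow_natCast]

theorem hasSum_kroneckerSym_nome {r : ℝ} (hr : 0 < r) :
    HasSum (fun n : ℕ => (kroneckerSym ((n : ℤ) + 2) 8 : ℝ) *
        (√(nome r) ^ n / (1 - nome r ^ n)))
      (-(ellipticK (singularModulus r) * singularModulus r /
        (√2 * π * √(1 + complModulus (singularModulus r))))) := by
  have hp0 : 0 < √(nome r) := sqrt_pos.2 (nome_pos r)
  have hp1 : √(nome r) < 1 := by
    rw [sqrt_lt' one_pos, one_pow]
    exact nome_lt_one hr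
  have h := hasSum_kroneckerSym_lambert hp0 hp1
  rwa [sq_sqrt (nome_pos r).le, ← ellipticK_mul_singularModulus_div hr] at h

/-- The sequence `q ^ (n + 1 / 2) / (1 - q ^ (2 n + 1))` with `q = nome r`. -/
noncomputable def lambertOdd (r : ℝ) (n : ℕ) : ℝ :=
  √(nome r) ^ (2 * n + 1) / (1 - nome r ^ (2 * n + 1))

theorem summable_lambertOdd {r : ℝ} (hr : 0 < r) : Summable fun n => ‖lambertOdd r n‖ := by
  have hq0 := nome_pos r
  have hq1 := nome_lt_one hr
  refine Summable.of_nonneg_of_le (fun n => norm_nonneg _) (fun n => ?_)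
    (((summable_geometric_of_lt_one hq0.le hq1).mul_left √(nome r)).div_const (1 - nome r))
  have h1 : nome r ^ (2 * n + 1) ≤ nome r :=
    pow_le_of_le_one hq0.le hq1.le (by omega)
  have h2 : 0 < 1 - nome r := by linarith
  have h3 : 0 < 1 - nome r ^ (2 * n + 1) := by linarith
  rw [lambertOdd, norm_of_nonneg (by positivity), pow_succ, pow_mul, sq_sqrt hq0.le, mul_comm]
  gcongr

theorem hasSum_kroneckerSym_lambertOdd {r : ℝ} (hr : 0 < r) :
    HasSum (fun n : ℕ => (kroneckerSym (2 * (n : ℤ) + 3) 8 : ℝ) * lambertOdd r n)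
      (-(ellipticK (singularModulus r) * singularModulus r /
        (√2 * π * √(1 + complModulus (singularModulus r))))) := by
  have hinj : Function.Injective fun n : ℕ => 2 * n + 1 := fun a b h => by simpa using h
  have h := (hinj.hasSum_iff ?_).2 (hasSum_kroneckerSym_nome hr)
  · convert h using 2 with n
    simp only [Function.comp_apply, lambertOdd]
    push_cast
    ring_nf
  · intro n hn
    rcases Nat.even_or_odd' n with ⟨m, rfl | rfl⟩
    · rw [show ((2 * m : ℕ) : ℤ) + 2 = 2 * (m + 1) by push_cast; ring, kroneckerSym_even]
      simp
    · exact absurd ⟨m, rfl⟩ hn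

theorem hasSum_kroneckerSym_pnat {r : ℝ} (hr : 0 < r) :
    HasSum (fun n : ℕ+ => (kroneckerSym ((n : ℤ) + 2) 8 : ℝ) *
        (nome r ^ ((n : ℝ) / 2) / (1 - nome r ^ (n : ℕ))))
      (-(ellipticK (singularModulus r) * singularModulus r /
        (√2 * π * √(1 + complModulus (singularModulus r))))) := by
  have h := (PNat.coe_injective.hasSum_iff ?_).2 (hasSum_kroneckerSym_nome hr)
  · convert h using 2 with n
    simp only [Function.comp_apply, rpow_nome_half]
  · intro n hn
    have : n = 0 := by
      by_contra h0
      exact hn ⟨⟨n, Nat.pos_of_ne_zero h0⟩, rfl⟩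
    simp [this, kroneckerSym_small.1]

theorem summable_lambertOdd_even {r : ℝ} (hr : 0 < r) :
    Summable fun m : ℕ => (-1) ^ m * lambertOdd r (2 * m) := by
  refine Summable.of_norm_bounded ((summable_lambertOdd hr).comp_injective
    (i := fun m : ℕ => 2 * m) fun a b h => by simpa using h) fun m => ?_
  simp

theorem hasSum_lambertOdd_even {r : ℝ} (hr : 0 < r) :
    HasSum (fun n : ℕ => (if Even n then (-1) ^ (n / 2) else 0) * lambertOdd r n)
      (∑' m : ℕ, (-1) ^ m * lambertOdd r (2 * m)) := by
  have hinj : Function.Injective fun n : ℕ => 2 * n := fun a b h => by simpa using h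
  refine (hinj.hasSum_iff ?_).1 ?_
  · intro n hn
    rw [if_neg, zero_mul]
    rintro ⟨m, rfl⟩
    exact hn ⟨m, two_mul m⟩
  · convert (summable_lambertOdd_even hr).hasSum using 2 with m
    simp

/-- The numbers congruent to `1` modulo `4`. -/
def oneModFourEquiv : ℕ ≃ {n : ℕ // n ≡ 1 [MOD 4]} where
  toFun m := ⟨4 * m + 1, by simp [Nat.ModEq]⟩
  invFun n := ((n : ℕ) - 1) / 4
  left_inv m := by simp
  right_inv n := by
    obtain ⟨n, hn⟩ := n
    have : n % 4 = 1 := hn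
    ext
    change 4 * ((n - 1) / 4) + 1 = n
    omega

theorem hasSum_oneModFour {r : ℝ} (hr : 0 < r) :
    HasSum (fun n : {n : ℕ // n ≡ 1 [MOD 4]} => (-1 : ℝ) ^ (((n : ℕ) - 1) / 4) *
        nome r ^ (((n : ℕ) : ℝ) / 2) / (1 - nome r ^ (n : ℕ)))
      (∑' m : ℕ, (-1) ^ m * lambertOdd r (2 * m)) := by
  refine oneModFourEquiv.hasSum_iff.1 ?_
  convert (summable_lambertOdd_even hr).hasSum using 2 with m
  simp only [Function.comp_apply, rpow_nome_half, oneModFourEquiv, Equiv.coe_fn_mk, lambertOdd]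
  rw [show (4 * m + 1 - 1) / 4 = m by omega, show 2 * (2 * m) + 1 = 4 * m + 1 by ring]
  ring

/-- The left side takes the values -1, 1, 1, -1 over √2 with period 4, while -χ(2n+1)/√2 gives 1, 1,
-1, -1 over √2. They differ only at even n, by ∓√2. -/
theorem neg_one_pow_mul_cos (n : ℕ) :
    (-1) ^ n * cos ((2 * n + 3) * (π / 4)) =
      -(kroneckerSym (2 * (n : ℤ) + 3) 8 : ℝ) / √2 - √2 * if Even n then (-1) ^ (n / 2) else 0 := by
  have h2 : √2 / 2 = 1 / √2 := by
    rw [div_eq_div_iff two_ne_zero (by positivity), one_mul]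
    exact mul_self_sqrt (by norm_num)
  have h3 : √2 = 2 / √2 := by
    rw [eq_div_iff (by positivity)]
    exact mul_self_sqrt (by norm_num)
  obtain ⟨k3, k5, k7, k9⟩ : kroneckerSym 3 8 = -1 ∧ kroneckerSym 5 8 = -1 ∧
      kroneckerSym 7 8 = 1 ∧ kroneckerSym 9 8 = 1 := by
    simp only [kroneckerSym_eight]
    decide
  have c0 : cos (3 * (π / 4)) = -(√2 / 2) := by
    rw [← cos_pi_div_four, ← cos_pi_sub]; ring_nf
  have c1 : cos (5 * (π / 4)) = -(√2 / 2) := by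
    rw [← cos_pi_div_four, ← cos_add_pi]; ring_nf
  have c2 : cos (7 * (π / 4)) = √2 / 2 := by
    rw [← cos_pi_div_four, ← cos_two_pi_sub]; ring_nf
  have c3 : cos (9 * (π / 4)) = √2 / 2 := by
    rw [← cos_pi_div_four, ← cos_add_two_pi (π / 4)]; ring_nf
  have hper (a : ℤ) (k : ℕ) : kroneckerSym (a + 8 * k) 8 = kroneckerSym a 8 := by
    rw [kroneckerSym_eight, kroneckerSym_eight]
    push_cast
    rw [show (8 : ZMod 8) = 0 from rfl, zero_mul, add_zero]
  have hcos (a : ℝ) (k : ℕ) : cos (a * (π / 4) + k * (2 * π)) = cos (a * (π / 4)) :=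
    cos_add_nat_mul_two_pi _ _
  obtain ⟨k, j, hj, rfl⟩ : ∃ k j : ℕ, j < 4 ∧ n = 4 * k + j :=
    ⟨n / 4, n % 4, Nat.mod_lt _ (by norm_num), (Nat.div_add_mod n 4).symm⟩
  have e1 : (2 * ((4 * k + j : ℕ) : ℝ) + 3) * (π / 4) = (2 * j + 3) * (π / 4) + k * (2 * π) := by
    push_cast
    ring
  have e2 : 2 * ((4 * k + j : ℕ) : ℤ) + 3 = (2 * j + 3) + 8 * k := by
    push_cast
    ring
  have e3 : (-1 : ℝ) ^ (4 * k + j) = (-1) ^ j := by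
    rw [pow_add, pow_mul]
    norm_num
  have e4 : (if Even (4 * k + j) then (-1 : ℝ) ^ ((4 * k + j) / 2) else 0) =
      if Even j then (-1) ^ (j / 2) else 0 := by
    have h4 : Even (4 * k) := ⟨2 * k, by ring⟩
    rw [show (4 * k + j) / 2 = 2 * k + j / 2 by omega, pow_add, pow_mul]
    simp [Nat.even_add, h4]
  rw [e1, e2, e3, e4, hper, hcos]
  rcases (by omega : j = 0 ∨ j = 1 ∨ j = 2 ∨ j = 3) with rfl | rfl | rfl | rfl
  · norm_num [k3, c0]
    rw [h2]
    nth_rw 3 [h3]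
    ring
  · norm_num [k5, c1]
    rw [h2]
    ring
  · norm_num [k7, c2]
    rw [h2]
    nth_rw 3 [h3]
    ring
  · norm_num [k9, c3, Nat.even_iff]
    rw [h2]
    ring

theorem cdOneTerm_half {r : ℝ} (hr : 0 < r) (n : ℕ) :
    cdOneTerm r ((ellipticK (singularModulus r) / 2 : ℝ) : ℂ) n =
      (((-1) ^ n * cos ((2 * n + 3) * (π / 4)) * lambertOdd r n : ℝ) : ℂ) := by
  obtain ⟨hk0, hk1, -⟩ := singularModulus_spec hr
  have hK : ((ellipticK (singularModulus r) : ℝ) : ℂ) ≠ 0 :=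
    Complex.ofReal_ne_zero.2 (ellipticK_pos hk0.le hk1).ne'
  have e1 : (2 * (n : ℂ) + 3) * ((π : ℂ) / (2 * (ellipticK (singularModulus r) : ℂ))) *
      ((ellipticK (singularModulus r) / 2 : ℝ) : ℂ) = (((2 * n + 3) * (π / 4) : ℝ) : ℂ) := by
    push_cast
    field_simp
    ring
  have e2 : nome r ^ ((n : ℝ) + 1 / 2) = √(nome r) ^ (2 * n + 1) := by
    rw [← rpow_nome_half]
    push_cast
    ring_nf
  rw [cdOneTerm, e1, e2, ← Complex.ofReal_cos, lambertOdd]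
  push_cast
  ring

theorem hasSum_cdOneTerm_half {r : ℝ} (hr : 0 < r) :
    HasSum (cdOneTerm r ((ellipticK (singularModulus r) / 2 : ℝ) : ℂ))
      ((ellipticK (singularModulus r) * singularModulus r /
        (√2 * π * √(1 + complModulus (singularModulus r))) / √2 -
        √2 * ∑' m : ℕ, (-1) ^ m * lambertOdd r (2 * m) : ℝ) : ℂ) := by
  rw [show cdOneTerm r ((ellipticK (singularModulus r) / 2 : ℝ) : ℂ) = _ from
    funext (cdOneTerm_half hr), Complex.hasSum_ofReal]
  have h := ((hasSum_kroneckerSym_lambertOdd hr).mul_left (-1 / √2)).sub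
    ((hasSum_lambertOdd_even hr).mul_left √2)
  have e : (fun n : ℕ => (-1) ^ n * cos ((2 * n + 3) * (π / 4)) * lambertOdd r n) =
      fun n : ℕ => -1 / √2 * ((kroneckerSym (2 * (n : ℤ) + 3) 8 : ℝ) * lambertOdd r n) -
        √2 * ((if Even n then (-1) ^ (n / 2) else 0) * lambertOdd r n) := by
    ext n
    rw [neg_one_pow_mul_cos]
    ring
  rw [e]
  generalize ellipticK (singularModulus r) * singularModulus r /
    (√2 * π * √(1 + complModulus (singularModulus r))) = L at h ⊢
  generalize ∑' m : ℕ, (-1) ^ m * lambertOdd r (2 * m) = B at h ⊢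
  rw [show L / √2 - √2 * B = -1 / √2 * -L - √2 * B by ring]
  exact h

end Corollary

theorem corollary4 (r : ℝ) (hr : 0 < r) (q k k' K : ℝ) (hq : q = nome r)
    (hk : k = singularModulus r) (hk' : k' = complModulus k) (hK : K = ellipticK k) :
    (Summable (cdOneTerm r ((K / 2 : ℝ) : ℂ)) ∧
      Summable (fun n : {n : ℕ // n ≡ 1 [MOD 4]} =>
        (-1 : ℝ) ^ (((n : ℕ) - 1) / 4) * q ^ (((n : ℕ) : ℝ) / 2) / (1 - q ^ (n : ℕ))) ∧
      cdOne r ((K / 2 : ℝ) : ℂ) =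
        ((1 / √(1 + k') - Real.pi * √8 / (K * k) *
          ∑' n : {n : ℕ // n ≡ 1 [MOD 4]},
            (-1 : ℝ) ^ (((n : ℕ) - 1) / 4) * q ^ (((n : ℕ) : ℝ) / 2) / (1 - q ^ (n : ℕ)) : ℝ) : ℂ)) ∧
    (Summable (fun n : ℕ+ =>
        (kroneckerSym ((n : ℤ) + 2) 8 : ℝ) * (q ^ ((n : ℝ) / 2) / (1 - q ^ (n : ℕ)))) ∧
      -∑' n : ℕ+, (kroneckerSym ((n : ℤ) + 2) 8 : ℝ) * (q ^ ((n : ℝ) / 2) / (1 - q ^ (n : ℕ))) =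
        K * k / (√2 * Real.pi * √(1 + k'))) := by
  subst hq hK hk' hk
  have h1 := hasSum_cdOneTerm_half hr
  have h2 := hasSum_oneModFour hr
  have h3 := hasSum_kroneckerSym_pnat hr
  refine ⟨⟨h1.summable, h2.summable, ?_⟩, h3.summable, by rw [h3.tsum_eq, neg_neg]⟩
  obtain ⟨hk0, hk1, -⟩ := singularModulus_spec hr
  have hK := ellipticK_pos hk0.le hk1
  have hk' := (complModulus_mem hk0 hk1).1
  rw [cdOne, h1.tsum_eq, h2.tsum_eq]
  generalize ∑' m : ℕ, (-1) ^ m * lambertOdd r (2 * m) = B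
  norm_cast
  have hs : 0 < √(1 + complModulus (singularModulus r)) := Real.sqrt_pos.2 (by linarith)
  have h22 : √2 * √2 = (2 : ℝ) := Real.mul_self_sqrt (by norm_num)
  have h8 : √8 = 2 * √2 := by
    rw [show (8 : ℝ) = 2 ^ 2 * 2 by norm_num, Real.sqrt_mul (by norm_num),
      Real.sqrt_sq (by norm_num)]
  have hpi := Real.pi_pos
  -- The prefactor 2π/(Kk) of `cdOne` turns the χ part into 1/√(1 + k'), and 2√2 = √8 gives the
  -- other coefficient.
  rw [h8, div_div, show √2 * Real.pi * √(1 + complModulus (singularModulus r)) * √2 =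
    2 * (Real.pi * √(1 + complModulus (singularModulus r))) by
    linear_combination Real.pi * √(1 + complModulus (singularModulus r)) * h22]
  field_simp
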